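/- There are universal constants $c, c', C > 0$ such that the following holds. Consider an MDP with finite nonempty state space $\mathcal S$ and action space $\mathcal A$, transition functions $P(\cdot\mid s,a)$, reward $r:\mathcal S\times\mathcal A\to\mathbb R$ and discount $\gamma\in(0,1)$; put $D=|\mathcal S|\,|\mathcal A|$. Let $\theta^*$ be its optimal $Q$-function, that is, the fixed point of the Bellman operator $$\theta\mapsto\Big((s,a)\mapsto r(s,a)+\gamma\,\mathbb E_{s'\sim P(\cdot\mid s,a)}\max_{a'}\theta(s',a')\Big).$$ A matrix sample is a random matrix $x$ of states whose entry $x(s,a)$ has law $P(\cdot\mid s,a)$; the matrix samples are independent of each other. The empirical Bellman operator of $x$ is $\widehat{\mathcal T}_x(\theta)(s,a)=r(s,a)+\gamma\max_{a'}\theta(x(s,a),a')$. Let $\sigma(\theta^*)(s,a)$ be the standard deviation of $\widehat{\mathcal T}_x(\theta^*)(s,a)$. For $\epsilon>0$ and $\delta\in(0,1)$ put $$B_0=\|\sigma(\theta^*)\|_\infty+(1-\gamma)\|\theta^*\|_\infty,\qquad M=\max\{1,\lceil\log_2(B_0/\epsilon)\rceil\},$$ $$T(\theta^*,\delta,\epsilon)=c\,\frac{\log\big(\frac{8MD}{(1-\gamma)\delta}\big)}{(1-\gamma)^3}\,\max\Big\{1,\log\frac{B_0}{\epsilon}\Big\}+c'\Big(\frac{B_0}{\epsilon}\Big)^2\frac{\log(8MD/\delta)}{(1-\gamma)^2}.$$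 (For $B_0=0$ the quantities $\log_2(B_0/\epsilon)$ and $\log(B_0/\epsilon)$ are read as $0$.) *Instance-dependent bound.* Variance-reduced $Q$-learning works in epochs, starting from $\bar\theta=0$. An epoch with recentering point $\bar\theta$, length $K\ge1$ and recentering size $N\ge1$ computes $\widetilde{\mathcal T}_N(\bar\theta)=\frac1N\sum_{i=1}^N\widehat{\mathcal T}_{y_i}(\bar\theta)$ from $N$ fresh matrix samples $y_i$, sets $\theta_1=\bar\theta$, performs with $K$ further fresh matrix samples $x_k$ the updates $$\theta_{k+1}=(1-\lambda_k)\theta_k+\lambda_k\big\{\widehat{\mathcal T}_{x_k}(\theta_k)-\widehat{\mathcal T}_{x_k}(\bar\theta)+\widetilde{\mathcal T}_N(\bar\theta)\big\},\qquad \lambda_k=\frac1{1+(1-\gamma)k},\quad k=1,\dots,K,$$ and passes $\theta_{K+1}$ on as the recentering point of the next epoch. The number of epochs, their lengths and their recentering sizes can be chosen, as functions of $(\gamma,\delta,D,M)$ only, so that the algorithm uses at most $T(\theta^*,\delta,\epsilon)$ matrix samples in total and its output $\bar\theta$ satisfies $\|\bar\theta-\theta^*\|_\infty\le\epsilon$ with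 probability at least $1-\delta$. *Worst case.* If moreover $\max_{s,a}|r(s,a)|\le r_{\max}$, then $B_0\le r_{\max}\big\{\frac2{1-\gamma}+1\big\}\le\frac{4r_{\max}}{1-\gamma}$, and, whenever $\epsilon\le r_{\max}/\sqrt{1-\gamma}$, $$T(\theta^*,\delta,\epsilon)\le C\,\frac{r_{\max}^2}{\epsilon^2}\,\frac{\log\big(\frac{8D}{(1-\gamma)\delta}\big)\,\log\big(\frac{4r_{\max}}{(1-\gamma)\epsilon}\big)}{(1-\gamma)^4}.$$ -/

import Mathlib

open MeasureTheory ProbabilityTheory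

namespace VRQ

noncomputable section

/-- The empirical Bellman operator built from one matrix sample `x`, whose entry `x (s, a)` is a
next state:  `θ ↦ ((s, a) ↦ r (s, a) + γ * max_{a'} θ (x (s, a), a'))`. -/
def empBellman {S A : Type*} (γ : ℝ) (r : S × A → ℝ) (x : S × A → S) (θ : S × A → ℝ) :
    S × A → ℝ :=
  fun sa => r sa + γ * ⨆ a', θ (x sa, a')

/-- The population Bellman operator
`θ ↦ ((s, a) ↦ r (s, a) + γ * E_{s' ∼ P (s, a)} max_{a'} θ (s', a'))`. -/
def bellman {S A : Type*} [MeasurableSpace S] (γ : ℝ) (r : S × A → ℝ) (P : S × A → PMF S)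
    (θ : S × A → ℝ) : S × A → ℝ :=
  fun sa => r sa + γ * ∫ s', (⨆ a', θ (s', a')) ∂(P sa).toMeasure

/-- `θ` is the optimal `Q`-function of the discounted MDP with transition functions `P`, reward
`r` and discount `γ`: the fixed point of the Bellman operator. -/
def IsOptimalQ {S A : Type*} [MeasurableSpace S] (γ : ℝ) (r : S × A → ℝ) (P : S × A → PMF S)
    (θ : S × A → ℝ) : Prop :=
  bellman γ r P θ = θ

theorem abs_iSup_sub_iSup_le {A : Type*} [Fintype A] [Nonempty A] (f g : A → ℝ) (K : ℝ)
    (h : ∀ a, |f a - g a| ≤ K) : |(⨆ a, f a) - ⨆ a, g a| ≤ K := by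
  have bf := (Set.finite_range f).bddAbove
  have bg := (Set.finite_range g).bddAbove
  rw [abs_le]
  constructor
  · have : (⨆ a, g a) ≤ (⨆ a, f a) + K := ciSup_le fun a => by
      have := le_ciSup bf a
      have := abs_le.1 (h a)
      linarith
    linarith
  · have : (⨆ a, f a) ≤ (⨆ a, g a) + K := ciSup_le fun a => by
      have := le_ciSup bg a
      have := abs_le.1 (h a)
      linarith
    linarith

/-- The fixed point of the Bellman operator exists and is unique. -/
theorem existsUnique_isOptimalQ {S A : Type*} [Fintype S] [MeasurableSpace S]
    [MeasurableSingletonClass S] [Fintype A] [Nonempty A] (γ : ℝ) (h0 : 0 < γ) (h1 : γ < 1)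
    (r : S × A → ℝ) (P : S × A → PMF S) : ∃! θ, IsOptimalQ γ r P θ := by
  have hc : ContractingWith ⟨γ, h0.le⟩ (bellman γ r P) := by
    refine ⟨by exact_mod_cast h1, LipschitzWith.of_dist_le_mul fun θ θ' => ?_⟩
    have hn : 0 ≤ γ * dist θ θ' := mul_nonneg h0.le dist_nonneg
    refine (dist_pi_le_iff hn).2 fun sa => ?_
    have hi : ∀ f : S → ℝ, Integrable f (P sa).toMeasure := fun f => Integrable.of_finite
    have e : bellman γ r P θ sa - bellman γ r P θ' sa =
        γ * ∫ s', ((⨆ a', θ (s', a')) - ⨆ a', θ' (s', a')) ∂(P sa).toMeasure := by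
      rw [integral_sub (hi _) (hi _)]
      simp only [bellman]
      ring
    rw [Real.dist_eq, e, abs_mul, abs_of_pos h0]
    refine mul_le_mul_of_nonneg_left ?_ h0.le
    have := norm_integral_le_of_norm_le_const (μ := (P sa).toMeasure)
      (f := fun s' => (⨆ a', θ (s', a')) - ⨆ a', θ' (s', a')) (C := dist θ θ')
      (Filter.Eventually.of_forall fun s' => abs_iSup_sub_iSup_le _ _ _ fun a => by
        rw [← Real.dist_eq]; exact dist_le_pi_dist θ θ' (s', a))
    simpa using this
  refine ⟨hc.fixedPoint, hc.fixedPoint_isFixedPt, fun θ hθ => hc.fixedPoint_unique hθ⟩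

/-- The matrix `σ(θ)` of standard deviations of the entries of the empirical Bellman update at
`θ`; entry `(s, a)` of a matrix sample is a next state with law `P (s, a)`. -/
def sigma {S A : Type*} [MeasurableSpace S] (γ : ℝ) (r : S × A → ℝ) (P : S × A → PMF S)
    (θ : S × A → ℝ) : S × A → ℝ :=
  fun sa => √(Var[fun s' => r sa + γ * ⨆ a', θ (s', a'); (P sa).toMeasure])

/-- The complexity parameter `B₀ = ‖σ(θ)‖_∞ + ‖θ‖_∞ (1 - γ)`
(the norm of a real function on a finite type is its sup norm). -/
def B0 {S A : Type*} [Fintype S] [Fintype A] [MeasurableSpace S] (γ : ℝ) (r : S × A → ℝ)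
    (P : S × A → PMF S) (θ : S × A → ℝ) : ℝ :=
  ‖sigma γ r P θ‖ + ‖θ‖ * (1 - γ)

/-! ### Variance-reduced Q-learning -/

/-- The Monte Carlo approximation of the Bellman update at `θ` from the `N` samples
`x 0, …, x (N - 1)`. -/
def mcBellman {S A : Type*} (γ : ℝ) (r : S × A → ℝ) (N : ℕ) (x : ℕ → S × A → S)
    (θ : S × A → ℝ) : S × A → ℝ :=
  (1 / (N : ℝ)) • ∑ i ∈ Finset.range N, empBellman γ r (x i) θ

/-- The iterates of the variance-reduced update with recentering point `θbar` and recentering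
matrix `Tbar`, started at `θbar`.  The value at `k` is the iterate after `k` updates; update
number `k + 1` uses the sample `x k` and the stepsize `1 / (1 + (1 - γ) (k + 1))`. -/
def epochIter {S A : Type*} (γ : ℝ) (r : S × A → ℝ) (θbar Tbar : S × A → ℝ)
    (x : ℕ → S × A → S) : ℕ → S × A → ℝ
  | 0 => θbar
  | k + 1 =>
    (1 - 1 / (1 + (1 - γ) * ((k : ℝ) + 1))) • epochIter γ r θbar Tbar x k +
      (1 / (1 + (1 - γ) * ((k : ℝ) + 1))) •
        (empBellman γ r (x k) (epochIter γ r θbar Tbar x k) - empBellman γ r (x k) θbar + Tbar)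

/-- One epoch: the samples `x 0, …, x (N - 1)` are used for recentering, the next `K` samples
for `K` variance-reduced updates. -/
def runEpoch {S A : Type*} (γ : ℝ) (r : S × A → ℝ) (θbar : S × A → ℝ) (K N : ℕ)
    (x : ℕ → S × A → S) : S × A → ℝ :=
  epochIter γ r θbar (mcBellman γ r N x θbar) (fun k => x (N + k)) K

/-- Successive epochs started at `θbar`, one for each pair
`(K, N) = (epoch length, recentering size)` of the plan, each on fresh samples. -/
def runEpochs {S A : Type*} (γ : ℝ) (r : S × A → ℝ) :
    (S × A → ℝ) → List (ℕ × ℕ) → (ℕ → S × A → S) → S × A → ℝ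
  | θbar, [], _ => θbar
  | θbar, (K, N) :: plan, x =>
    runEpochs γ r (runEpoch γ r θbar K N x) plan (fun i => x (N + K + i))

/-- The output of variance-reduced Q-learning, initialized at `0`. -/
def vrQLearning {S A : Type*} (γ : ℝ) (r : S × A → ℝ) (plan : List (ℕ × ℕ))
    (x : ℕ → S × A → S) : S × A → ℝ :=
  runEpochs γ r 0 plan x

/-- The total number of matrix samples used by a plan. -/
def totalSamples (plan : List (ℕ × ℕ)) : ℕ :=
  (plan.map fun e => e.1 + e.2).sum

/-- Sampling from the generative model: the random matrices `X 0, X 1, …` are independent, and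
entry `(s, a)` of each of them is a state with law `P (s, a)`.  (The entries of one matrix may
be independent or coupled in any way.) -/
structure IsGenerativeSampling {S A Ω : Type*} [MeasurableSpace S] [MeasurableSpace Ω]
    (P : S × A → PMF S) (μ : Measure Ω) (X : ℕ → Ω → S × A → S) : Prop where
  measurable : ∀ i, Measurable (X i)
  indep : iIndepFun X μ
  law : ∀ i sa, μ.map (fun ω => X i ω sa) = (P sa).toMeasure

/-! ### The sample size -/

/-- The number `M = ⌈log₂ (B / ε)⌉`, and at least one. -/
def numEpochs (B ε : ℝ) : ℕ :=
  max 1 ⌈Real.logb 2 (B / ε)⌉₊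

/-- The instance-dependent sample size, where `B` stands for `B₀` and `D` for the number of
state-action pairs. -/
def sampleSize (c c' γ : ℝ) (D : ℕ) (δ ε B : ℝ) : ℝ :=
  c * (Real.log (8 * numEpochs B ε * D / ((1 - γ) * δ)) / (1 - γ) ^ 3)
      * max 1 (Real.log (B / ε))
    + c' * (B / ε) ^ 2 * (Real.log (8 * numEpochs B ε * D / δ) / (1 - γ) ^ 2)

/-- The worst-case sample size over rewards bounded by `rmax`. -/
def worstSampleSize (C γ : ℝ) (D : ℕ) (δ ε rmax : ℝ) : ℝ :=
  C * (rmax ^ 2 / ε ^ 2) *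
    (Real.log (8 * D / ((1 - γ) * δ)) * Real.log (4 * rmax / ((1 - γ) * ε)) / (1 - γ) ^ 4)

end

end VRQ

namespace VRQ

/-! ### Concentration: Bernstein for plain averages, sub-Gaussian tails for weighted sums. -/

section Concentration

variable {Ω : Type*} [MeasurableSpace Ω] {μ : Measure Ω} [IsProbabilityMeasure μ]

/-! Write `h = 1/(1-γ)`. Since `‖θstar‖ ≤ h * B₀`, the start `0` has error at most `h * B₀`. Halving
this by full epochs down to `B₀` would take about `log h` extra epochs at a cost of order `h^3`
each, which the sample size does not allow. The plan therefore has two phases.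

Warm-up, from `h * B` to `B/2`: epochs of length one, which are damped Monte Carlo value iteration
(`reaches_valueIteration_step`). If the value error takes values in `[-b, b]`, has mean `m` and
variance `v^2`, then `|m| + v^2/(2b) ≤ b` (`integral_add_variance_le`). A large variance thus forces
slack in the mean, and this slack absorbs the part of the Bernstein deviation due to the current
error (`step_error_le`). About `L * h^2 * B / b` samples give a contraction by `1 - (1-γ)/4`; along
the warm-up these costs form a geometric series of total order `L * h^3`.

Refinement, from `B/2` to `B/2^M`: each epoch halves the error (`reaches_varianceReduced_epoch`).
Recentering costs of order `h^2 * (B/b)^2` by Bernstein. Inside an epoch the iterate is `θstar`,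
plus a linear running average of centred noise of size `b`, plus a remainder. The average is
sub-Gaussian with proxy about `b^2 * h/(k+h)` (`noiseAvg_deviation`); the remainder obeys a
deterministic sup-norm recursion (`epochIter_sub_noiseAvg_le`). Length of order `L * h^3` suffices.

Each guarantee is uniform in the starting point, so phases on independent samples compose
(`Reaches.append`). The analysis is run with `2^M * ε ≥ B₀` in place of `B₀`. The sample sizes
involve only ratios of errors to this scale, so the plan depends on `M` but not on `B₀` or `ε`, and
the final error is exactly `ε`. The worst-case bound is then scalar arithmetic (`worst_case_arith`).
-/

theorem integrable_of_abs_le {W : Ω → ℝ} {a : ℝ} (hm : Measurable W) (hb : ∀ ω, |W ω| ≤ a) :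
    Integrable W μ :=
  Integrable.of_bound hm.aestronglyMeasurable a (Filter.Eventually.of_forall hb)

/-- The Bernstein bound on the moment generating function of a bounded centred variable. -/
theorem mgf_le_exp_of_bounded {W : Ω → ℝ} {a v t : ℝ} (hm : Measurable W)
    (hb : ∀ ω, |W ω| ≤ a) (h0 : ∫ ω, W ω ∂μ = 0) (h2 : ∫ ω, W ω ^ 2 ∂μ ≤ v)
    (ht : |t| * a ≤ 1) : mgf W μ t ≤ Real.exp (t ^ 2 * v) := by
  have hx : ∀ ω, |t * W ω| ≤ 1 := fun ω => by
    rw [abs_mul]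
    exact (mul_le_mul_of_nonneg_left (hb ω) (abs_nonneg t)).trans ht
  have i1 : Integrable W μ := integrable_of_abs_le hm hb
  have i2 : Integrable (fun ω => W ω ^ 2) μ :=
    integrable_of_abs_le (a := a ^ 2) (hm.pow_const 2) fun ω => by
      rw [abs_pow]
      exact pow_le_pow_left₀ (abs_nonneg _) (hb ω) 2
  have ie : Integrable (fun ω => Real.exp (t * W ω)) μ :=
    integrable_of_abs_le (a := Real.exp 1) (by fun_prop) fun ω => by
      rw [abs_of_pos (Real.exp_pos _)]
      exact Real.exp_le_exp.2 ((le_abs_self _).trans (hx ω))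
  calc mgf W μ t = ∫ ω, Real.exp (t * W ω) ∂μ := rfl
    _ ≤ ∫ ω, (1 + t * W ω + t ^ 2 * W ω ^ 2) ∂μ := by
        refine integral_mono ie (((integrable_const 1).add (i1.const_mul t)).add
          (i2.const_mul (t ^ 2))) fun ω => ?_
        have := (abs_le.1 (Real.abs_exp_sub_one_sub_id_le (hx ω))).2
        simp only
        nlinarith
    _ = 1 + t ^ 2 * ∫ ω, W ω ^ 2 ∂μ := by
        have e1 : Integrable (fun ω => 1 + t * W ω) μ := (integrable_const 1).add (i1.const_mul t)
        rw [integral_add e1 (i2.const_mul (t ^ 2)),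
          integral_add (integrable_const 1) (i1.const_mul t), integral_const_mul,
          integral_const_mul, h0]
        simp
    _ ≤ Real.exp (t ^ 2 * v) := by
        have := Real.add_one_le_exp (t ^ 2 * v)
        have := mul_le_mul_of_nonneg_left h2 (sq_nonneg t)
        linarith

/-- Choice of the Chernoff parameter. With `w = √(L/N)`, the optimum `N * w / s` for the variance
term is admissible when `a * w ≤ s`; otherwise the largest admissible value `N / a` is good enough.
-/
theorem exists_bernstein_exponent {s a L N : ℝ} (hs : 0 ≤ s) (ha : 0 < a) (hL : 0 < L)
    (hN : 0 < N) : ∃ t : ℝ, 0 ≤ t ∧ t / N * a ≤ 1 ∧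
      -t * (2 * s * √(L / N) + a * (L / N)) + N * ((t / N) ^ 2 * s ^ 2) ≤ -L := by
  obtain ⟨w, hw, hw2⟩ : ∃ w : ℝ, 0 < w ∧ L = N * w ^ 2 :=
    ⟨√(L / N), Real.sqrt_pos.2 (by positivity), by
      rw [Real.sq_sqrt (by positivity)]; field_simp⟩
  have e : L / N = w ^ 2 := by rw [hw2]; field_simp
  rw [e, Real.sqrt_sq hw.le, hw2]
  rcases le_or_gt (a * w) s with h | h
  · have hs0 : 0 < s := lt_of_lt_of_le (by positivity) h
    refine ⟨N * w / s, by positivity, ?_, ?_⟩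
    · rw [show N * w / s / N * a = a * w / s by field_simp]
      exact (div_le_one hs0).2 h
    · have : -(N * w / s) * (2 * s * w + a * w ^ 2) + N * ((N * w / s / N) ^ 2 * s ^ 2)
          = -(N * w ^ 2) - N * w / s * (a * w ^ 2) := by field_simp; ring
      rw [this]
      have : 0 ≤ N * w / s * (a * w ^ 2) := by positivity
      linarith
  · refine ⟨N / a, by positivity, ?_, ?_⟩
    · apply le_of_eq; field_simp
    · have : -(N / a) * (2 * s * w + a * w ^ 2) + N * ((N / a / N) ^ 2 * s ^ 2)
          = -(N * w ^ 2) - N * s / a ^ 2 * (2 * (a * w) - s) := by field_simp; ring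
      rw [this]
      have : 0 ≤ N * s / a ^ 2 * (2 * (a * w) - s) :=
        mul_nonneg (by positivity) (by nlinarith)
      linarith

/-- Bernstein's inequality (upper tail) for an average of `N` independent centred variables. -/
theorem bernstein_upper {W : ℕ → Ω → ℝ} {a s L : ℝ} {N : ℕ} (hi : iIndepFun W μ)
    (hm : ∀ i, Measurable (W i)) (hb : ∀ i ω, |W i ω| ≤ a) (h0 : ∀ i, ∫ ω, W i ω ∂μ = 0)
    (h2 : ∀ i, ∫ ω, W i ω ^ 2 ∂μ ≤ s ^ 2) (hs : 0 ≤ s) (ha : 0 < a) (hL : 0 < L) (hN : 1 ≤ N) :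
    μ.real {ω | 2 * s * √(L / N) + a * (L / N) ≤ 1 / (N : ℝ) * ∑ i ∈ Finset.range N, W i ω}
      ≤ Real.exp (-L) := by
  have hN0 : (0 : ℝ) < N := by exact_mod_cast hN
  obtain ⟨t, ht0, hta, hte⟩ := exists_bernstein_exponent hs ha hL hN0
  have hS : Measurable (∑ i ∈ Finset.range N, W i) :=
    (Finset.sum_fn (Finset.range N) W).symm ▸ Finset.measurable_sum _ fun i _ => hm i
  have hSb : ∀ ω, |(∑ i ∈ Finset.range N, W i) ω| ≤ N * a := fun ω => by
    rw [Finset.sum_apply]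
    refine (Finset.abs_sum_le_sum_abs _ _).trans ?_
    simpa using Finset.sum_le_sum (s := Finset.range N) fun i _ => hb i ω
  have hint : Integrable (fun ω => Real.exp (t / N * (∑ i ∈ Finset.range N, W i) ω)) μ :=
    integrable_of_abs_le (a := Real.exp (t / N * (N * a))) (by fun_prop) fun ω => by
      rw [abs_of_pos (Real.exp_pos _)]
      exact Real.exp_le_exp.2 (mul_le_mul_of_nonneg_left ((le_abs_self _).trans (hSb ω))
        (by positivity))
  have key := measure_ge_le_exp_mul_mgf (μ := μ) (N * (2 * s * √(L / N) + a * (L / N)))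
    (by positivity : 0 ≤ t / N) hint
  have hset : {ω | 2 * s * √(L / N) + a * (L / N) ≤ 1 / (N : ℝ) * ∑ i ∈ Finset.range N, W i ω}
      = {ω | N * (2 * s * √(L / N) + a * (L / N)) ≤ (∑ i ∈ Finset.range N, W i) ω} := by
    ext ω
    simp only [Set.mem_ofPred_eq, Finset.sum_apply]
    rw [one_div, ← div_eq_inv_mul, le_div_iff₀ hN0, mul_comm]
  rw [hset]
  refine key.trans ?_
  rw [hi.mgf_sum hm]
  have hp : ∏ i ∈ Finset.range N, mgf (W i) μ (t / N) ≤ Real.exp (N * ((t / N) ^ 2 * s ^ 2)) := by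
    calc _ ≤ ∏ i ∈ Finset.range N, Real.exp ((t / N) ^ 2 * s ^ 2) :=
          Finset.prod_le_prod (fun i _ => mgf_nonneg) fun i _ =>
            mgf_le_exp_of_bounded (hm i) (hb i) (h0 i) (h2 i) (by
              rwa [abs_of_nonneg (by positivity)])
      _ = _ := by rw [Finset.prod_const, Finset.card_range, ← Real.exp_nat_mul]
  calc _ ≤ Real.exp (-(t / N) * (N * (2 * s * √(L / N) + a * (L / N))))
        * Real.exp (N * ((t / N) ^ 2 * s ^ 2)) :=
        mul_le_mul_of_nonneg_left hp (Real.exp_pos _).le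
    _ ≤ _ := by
      rw [← Real.exp_add]
      refine Real.exp_le_exp.2 (le_of_eq_of_le ?_ hte)
      congr 1
      field_simp

/-- Bernstein's inequality for an average of `N` independent centred variables. -/
theorem bernstein {W : ℕ → Ω → ℝ} {a s L : ℝ} {N : ℕ} (hi : iIndepFun W μ)
    (hm : ∀ i, Measurable (W i)) (hb : ∀ i ω, |W i ω| ≤ a) (h0 : ∀ i, ∫ ω, W i ω ∂μ = 0)
    (h2 : ∀ i, ∫ ω, W i ω ^ 2 ∂μ ≤ s ^ 2) (hs : 0 ≤ s) (ha : 0 < a) (hL : 0 < L) (hN : 1 ≤ N) :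
    μ.real {ω | 2 * s * √(L / N) + a * (L / N) < |1 / (N : ℝ) * ∑ i ∈ Finset.range N, W i ω|}
      ≤ 2 * Real.exp (-L) := by
  have u := bernstein_upper hi hm hb h0 h2 hs ha hL hN
  have l := bernstein_upper (μ := μ) (W := fun i ω => -W i ω) (a := a) (s := s) (L := L) (N := N)
    (hi.comp (fun _ x => -x) fun _ => measurable_neg) (fun i => (hm i).neg)
    (fun i ω => by rw [abs_neg]; exact hb i ω) (fun i => by rw [integral_neg, h0, neg_zero])
    (fun i => by simpa using h2 i) hs ha hL hN
  refine (measureReal_mono ?_ (measure_ne_top _ _)).trans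
    ((measureReal_union_le _ _).trans ((add_le_add u l).trans_eq (two_mul _).symm))
  intro ω hω
  simp only [Set.mem_ofPred_eq] at hω
  rcases lt_abs.1 hω with h | h
  · exact Or.inl h.le
  · refine Or.inr ?_
    simp only [Set.mem_ofPred_eq, Finset.sum_neg_distrib, mul_neg]
    exact h.le

/-- The weights of the running average `p ↦ (1 - l k) p + l k w`. -/
noncomputable def avgWeight (l : ℕ → ℝ) : ℕ → ℕ → ℝ
  | 0, _ => 0
  | k + 1, j => if j = k then l k else (1 - l k) * avgWeight l k j

theorem sum_avgWeight_succ (l w : ℕ → ℝ) (k : ℕ) :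
    ∑ j ∈ Finset.range (k + 1), avgWeight l (k + 1) j * w j
      = (1 - l k) * ∑ j ∈ Finset.range k, avgWeight l k j * w j + l k * w k := by
  rw [Finset.sum_range_succ, Finset.mul_sum]
  congr 1
  · refine Finset.sum_congr rfl fun j hj => ?_
    rw [avgWeight, if_neg (Finset.mem_range.1 hj).ne]
    ring
  · rw [avgWeight, if_pos rfl]

/-- Inductively, with `l' = l (k+1)`, the sum is at most `(1-l')^2 * l k + l'^2 ≤ (1-l') * l' + l'^2
= l'`. The latest step size thus controls the variance of the running average. -/
theorem sum_avgWeight_sq_le {l : ℕ → ℝ} (h0 : ∀ k, 0 ≤ l k) (h1 : ∀ k, l k ≤ 1)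
    (hl : ∀ k, (1 - l (k + 1)) * l k ≤ l (k + 1)) (k : ℕ) :
    ∑ j ∈ Finset.range (k + 1), avgWeight l (k + 1) j ^ 2 ≤ l k := by
  induction k with
  | zero => simpa [avgWeight] using by nlinarith [h0 0, h1 0]
  | succ k ih =>
    rw [Finset.sum_range_succ, avgWeight, if_pos rfl]
    have : ∑ j ∈ Finset.range (k + 1), avgWeight l (k + 1 + 1) j ^ 2
        = (1 - l (k + 1)) ^ 2 * ∑ j ∈ Finset.range (k + 1), avgWeight l (k + 1) j ^ 2 := by
      rw [Finset.mul_sum]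
      refine Finset.sum_congr rfl fun j hj => ?_
      rw [avgWeight, if_neg (Finset.mem_range.1 hj).ne]
      ring
    rw [this]
    have a := mul_le_mul_of_nonneg_left ih (sq_nonneg (1 - l (k + 1)))
    have b := mul_le_mul_of_nonneg_left (hl k) (sub_nonneg.2 (h1 (k + 1)))
    nlinarith

omit [IsProbabilityMeasure μ] in
theorem subgaussian_upper {W : ℕ → Ω → ℝ} {c : NNReal} (hi : iIndepFun W μ)
    (hW : ∀ i, HasSubgaussianMGF (W i) c μ) (w : ℕ → ℝ) (k : ℕ) {v x : ℝ} (hv : 0 < v)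
    (hw : (∑ j ∈ Finset.range k, w j ^ 2) * c ≤ v) (hx : 0 ≤ x) :
    μ.real {ω | x ≤ ∑ j ∈ Finset.range k, w j * W j ω} ≤ Real.exp (-x ^ 2 / (2 * v)) := by
  have hi' : iIndepFun (fun j ω => w j * W j ω) μ :=
    hi.comp (fun j y => w j * y) fun j => measurable_const_mul _
  have hs := HasSubgaussianMGF.sum_of_iIndepFun hi' (s := Finset.range k)
    (c := fun j => ⟨w j ^ 2, sq_nonneg _⟩ * c) fun j _ => (hW j).const_mul (w j)
  have hc : ((∑ j ∈ Finset.range k, (⟨w j ^ 2, sq_nonneg _⟩ * c : NNReal) : NNReal) : ℝ) ≤ v := by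
    refine le_of_eq_of_le ?_ hw
    rw [NNReal.coe_sum, Finset.sum_mul]
    rfl
  obtain ⟨v, rfl⟩ : ∃ v' : NNReal, (v' : ℝ) = v := ⟨⟨v, hv.le⟩, rfl⟩
  have hm : HasSubgaussianMGF (fun ω => ∑ j ∈ Finset.range k, w j * W j ω) v μ :=
    ⟨hs.integrable_exp_mul, fun t => (hs.mgf_le t).trans (Real.exp_le_exp.2
      (div_le_div_of_nonneg_right (mul_le_mul_of_nonneg_right hc (sq_nonneg t)) two_pos.le))⟩
  exact hm.measure_ge_le hx

theorem subgaussian_abs {W : ℕ → Ω → ℝ} {c : NNReal} (hi : iIndepFun W μ)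
    (hW : ∀ i, HasSubgaussianMGF (W i) c μ) (w : ℕ → ℝ) (k : ℕ) {v x : ℝ} (hv : 0 < v)
    (hw : (∑ j ∈ Finset.range k, w j ^ 2) * c ≤ v) (hx : 0 ≤ x) :
    μ.real {ω | x < |∑ j ∈ Finset.range k, w j * W j ω|} ≤ 2 * Real.exp (-x ^ 2 / (2 * v)) := by
  have u := subgaussian_upper hi hW w k hv hw hx
  have l := subgaussian_upper hi hW (fun j => -w j) k hv (by simpa using hw) hx
  refine (measureReal_mono ?_ (measure_ne_top _ _)).trans
    ((measureReal_union_le _ _).trans ((add_le_add u l).trans_eq (two_mul _).symm))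
  intro ω hω
  simp only [Set.mem_ofPred_eq] at hω
  rcases lt_abs.1 hω with h | h
  · exact Or.inl h.le
  · refine Or.inr ?_
    simp only [Set.mem_ofPred_eq, neg_mul, Finset.sum_neg_distrib]
    exact h.le

end Concentration

/-! ### Runs depend only on the samples they consume, and concatenate. -/

section Runs

variable {S A : Type*} {γ : ℝ} {r : S × A → ℝ}

theorem mcBellman_congr {N : ℕ} {x x' : ℕ → S × A → S} (h : ∀ i < N, x i = x' i)
    (θ : S × A → ℝ) : mcBellman γ r N x θ = mcBellman γ r N x' θ := by
  unfold mcBellman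
  congr 1
  exact Finset.sum_congr rfl fun i hi => by rw [h i (Finset.mem_range.1 hi)]

theorem epochIter_congr {θbar Tbar : S × A → ℝ} {K : ℕ} {x x' : ℕ → S × A → S}
    (h : ∀ i < K, x i = x' i) :
    epochIter γ r θbar Tbar x K = epochIter γ r θbar Tbar x' K := by
  induction K with
  | zero => rfl
  | succ k ih => simp only [epochIter, ih fun i hi => h i (by omega), h k (by omega)]

theorem runEpoch_congr {θbar : S × A → ℝ} {K N : ℕ} {x x' : ℕ → S × A → S}
    (h : ∀ i < N + K, x i = x' i) : runEpoch γ r θbar K N x = runEpoch γ r θbar K N x' := by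
  unfold runEpoch
  rw [mcBellman_congr fun i hi => h i (by omega)]
  exact epochIter_congr fun i hi => h _ (by omega)

theorem totalSamples_cons (e : ℕ × ℕ) (p : List (ℕ × ℕ)) :
    totalSamples (e :: p) = e.1 + e.2 + totalSamples p := by
  simp [totalSamples]

theorem totalSamples_append (p p' : List (ℕ × ℕ)) :
    totalSamples (p ++ p') = totalSamples p + totalSamples p' := by
  simp [totalSamples]

/-- Lets a run be factored through a finite block of samples, which is where independence is
applied. -/
theorem runEpochs_congr {p : List (ℕ × ℕ)} {θ : S × A → ℝ} {x x' : ℕ → S × A → S}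
    (h : ∀ i < totalSamples p, x i = x' i) : runEpochs γ r θ p x = runEpochs γ r θ p x' := by
  induction p generalizing θ x x' with
  | nil => rfl
  | cons e p ih =>
    obtain ⟨K, N⟩ := e
    simp only [totalSamples_cons] at h
    simp only [runEpochs]
    rw [runEpoch_congr fun i hi => h i (by omega)]
    exact ih fun i hi => h _ (by omega)

theorem runEpochs_append (p p' : List (ℕ × ℕ)) (θ : S × A → ℝ) (x : ℕ → S × A → S) :
    runEpochs γ r θ (p ++ p') x
      = runEpochs γ r (runEpochs γ r θ p x) p' fun i => x (totalSamples p + i) := by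
  induction p generalizing θ x with
  | nil => simp [runEpochs, totalSamples]
  | cons e p ih =>
    obtain ⟨K, N⟩ := e
    simp only [List.cons_append, runEpochs, ih, totalSamples_cons]
    congr 1
    funext i
    congr 1
    omega

end Runs

/-! ### Composing probabilistic error guarantees. -/

section Composition

variable {S A Ω : Type*} [Fintype S] [MeasurableSpace S]
  [MeasurableSingletonClass S] [Fintype A] [MeasurableSpace Ω]
  {μ : Measure Ω} [IsProbabilityMeasure μ] {γ : ℝ} {r : S × A → ℝ} {P : S × A → PMF S}
  {θstar : S × A → ℝ}

/-- With probability at least `1 - q`, the epochs of `p` bring the error from `b` to `b'`. -/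
def Reaches (μ : Measure Ω) (γ : ℝ) (r : S × A → ℝ) (P : S × A → PMF S) (θstar : S × A → ℝ)
    (p : List (ℕ × ℕ)) (b b' q : ℝ) : Prop :=
  ∀ θ, ‖θ - θstar‖ ≤ b → ∀ X : ℕ → Ω → S × A → S, IsGenerativeSampling P μ X →
    μ.real {ω | b' < ‖runEpochs γ r θ p (fun i => X i ω) - θstar‖} ≤ q

omit [Fintype S] [MeasurableSingletonClass S] [Fintype A]
  [IsProbabilityMeasure μ] in
theorem IsGenerativeSampling.shift {X : ℕ → Ω → S × A → S} (hX : IsGenerativeSampling P μ X)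
    (n : ℕ) : IsGenerativeSampling P μ fun i => X (n + i) :=
  ⟨fun _ => hX.measurable _, hX.indep.precomp (add_right_injective n), fun _ => hX.law _⟩

/-- Condition on the first block of samples. It takes finitely many values, and each fixes the
starting point of the second run. For good values the second guarantee applies on the independent
second block with failure at most `q'`, and the probabilities of the good values sum to at most one.
-/
theorem Reaches.append {p p' : List (ℕ × ℕ)} {b b' b'' q q' : ℝ}
    (h : Reaches μ γ r P θstar p b b' q) (h' : Reaches μ γ r P θstar p' b' b'' q')
    (hq' : 0 ≤ q') : Reaches μ γ r P θstar (p ++ p') b b'' (q + q') := by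
  classical
  intro θ hθ X hX
  set n := totalSamples p with hn
  set m := totalSamples p' with hm
  let U : Finset ℕ := Finset.range n
  let V : Finset ℕ := (Finset.range m).image (n + ·)
  let Y : Ω → U → S × A → S := fun ω i => X i ω
  let Z : Ω → V → S × A → S := fun ω i => X i ω
  have hYZ : IndepFun Y Z μ := hX.indep.indepFun_finset U V (by
    rw [Finset.disjoint_left]
    intro i hi hi'
    simp only [U, V, Finset.mem_range, Finset.mem_image] at hi hi'
    obtain ⟨j, _, rfl⟩ := hi'
    omega) hX.measurable
  have hYm : Measurable Y := measurable_pi_lambda _ fun i => hX.measurable _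
  have hZm : Measurable Z := measurable_pi_lambda _ fun i => hX.measurable _
  -- A filler outside the two blocks; the runs never read it.
  let x0 : S × A → S := fun sa => sa.1
  let F : (U → S × A → S) → S × A → ℝ := fun y =>
    runEpochs γ r θ p fun i => if hi : i ∈ U then y ⟨i, hi⟩ else x0
  let G : (S × A → ℝ) → (V → S × A → S) → S × A → ℝ := fun v z =>
    runEpochs γ r v p' fun i => if hi : n + i ∈ V then z ⟨n + i, hi⟩ else x0
  have hF : ∀ ω, runEpochs γ r θ p (fun i => X i ω) = F (Y ω) := fun ω =>
    runEpochs_congr fun i hi => by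
      have : i ∈ U := Finset.mem_range.2 hi
      simp [this, Y]
  have hG : ∀ v ω, runEpochs γ r v p' (fun i => X (n + i) ω) = G v (Z ω) := fun v ω =>
    runEpochs_congr fun i hi => by
      have : n + i ∈ V := Finset.mem_image.2 ⟨i, Finset.mem_range.2 hi, rfl⟩
      simp [this, Z]
  let good : Finset (U → S × A → S) := Finset.univ.filter fun y => ‖F y - θstar‖ ≤ b'
  have hsub : {ω | b'' < ‖runEpochs γ r θ (p ++ p') (fun i => X i ω) - θstar‖} ⊆
      {ω | b' < ‖runEpochs γ r θ p (fun i => X i ω) - θstar‖} ∪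
        ⋃ y ∈ good, Y ⁻¹' {y} ∩ Z ⁻¹' {z | b'' < ‖G (F y) z - θstar‖} := by
    intro ω hω
    simp only [Set.mem_ofPred_eq, runEpochs_append, ← hn] at hω
    rw [hG, hF] at hω
    by_cases hg : ‖F (Y ω) - θstar‖ ≤ b'
    · refine Or.inr (Set.mem_iUnion₂.2 ⟨Y ω, Finset.mem_filter.2 ⟨Finset.mem_univ _, hg⟩, rfl, hω⟩)
    · left
      simp only [Set.mem_ofPred_eq, hF]
      exact not_le.1 hg
  refine (measureReal_mono hsub (measure_ne_top _ _)).trans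
    ((measureReal_union_le _ _).trans (add_le_add (h θ hθ X hX) ?_))
  refine (measureReal_biUnion_finset_le _ _).trans ?_
  have hterm : ∀ y ∈ good, μ.real (Y ⁻¹' {y} ∩ Z ⁻¹' {z | b'' < ‖G (F y) z - θstar‖})
      ≤ μ.real (Y ⁻¹' {y}) * q' := by
    intro y hy
    have e := hYZ.measure_inter_preimage_eq_mul {y} {z | b'' < ‖G (F y) z - θstar‖}
      (MeasurableSet.of_discrete) (MeasurableSet.of_discrete)
    rw [measureReal_def, e, ENNReal.toReal_mul]
    refine mul_le_mul_of_nonneg_left ?_ ENNReal.toReal_nonneg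
    have := h' (F y) (Finset.mem_filter.1 hy).2 _ (hX.shift n)
    simp only [hG] at this
    exact this
  refine (Finset.sum_le_sum hterm).trans ?_
  rw [← Finset.sum_mul]
  refine mul_le_of_le_one_left hq' ?_
  rw [← measureReal_biUnion_finset (fun y _ y' _ hyy => Set.disjoint_left.2 fun ω h1 h2 =>
    hyy (h1.symm.trans h2)) fun y _ => hYm (MeasurableSet.of_discrete)]
  exact measureReal_le_one

omit [MeasurableSingletonClass S] [IsProbabilityMeasure μ] in
theorem Reaches.nil (b : ℝ) : Reaches μ γ r P θstar [] b b 0 := by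
  intro θ hθ X _
  have : {ω : Ω | b < ‖runEpochs γ r θ [] (fun i => X i ω) - θstar‖} = ∅ :=
    Set.eq_empty_of_forall_notMem fun ω hω => absurd hθ (not_le.2 hω)
  rw [this, measureReal_empty]

theorem Reaches.map_range {n : ℕ} {e : ℕ → ℕ × ℕ} {β : ℕ → ℝ} {q : ℝ} (hq : 0 ≤ q)
    (h : ∀ i < n, Reaches μ γ r P θstar [e i] (β i) (β (i + 1)) q) :
    Reaches μ γ r P θstar ((List.range n).map e) (β 0) (β n) (n * q) := by
  induction n with
  | zero => simpa using Reaches.nil _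
  | succ n ih =>
    rw [List.range_succ, List.map_append]
    push_cast
    rw [add_mul, one_mul]
    exact (ih fun i hi => h i (by omega)).append (h n (by omega)) hq

end Composition

/-! ### Value functions, and mean and variance of bounded functions. -/

section Values

variable {S A : Type*} [Fintype S] [Fintype A] [Nonempty A]

/-- The value function `s ↦ max_a θ (s, a)`. -/
noncomputable def vmax {S A : Type*} (θ : S × A → ℝ) (s : S) : ℝ := ⨆ a, θ (s, a)

theorem abs_vmax_sub_le (θ θ' : S × A → ℝ) (s : S) : |vmax θ s - vmax θ' s| ≤ ‖θ - θ'‖ :=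
  abs_iSup_sub_iSup_le _ _ _ fun a => norm_le_pi_norm (θ - θ') (s, a)

theorem abs_vmax_le (θ : S × A → ℝ) (s : S) : |vmax θ s| ≤ ‖θ‖ := by
  have := abs_vmax_sub_le θ 0 s
  simpa [vmax] using this

omit [Fintype S] [Fintype A] [Nonempty A] in
theorem empBellman_apply (γ : ℝ) (r : S × A → ℝ) (x : S × A → S) (θ : S × A → ℝ) (sa : S × A) :
    empBellman γ r x θ sa = r sa + γ * vmax θ (x sa) := rfl

theorem abs_empBellman_sub_le {γ : ℝ} (h0 : 0 ≤ γ) (r : S × A → ℝ) (x : S × A → S)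
    (θ θ' : S × A → ℝ) (sa : S × A) :
    |empBellman γ r x θ sa - empBellman γ r x θ' sa| ≤ γ * ‖θ - θ'‖ := by
  rw [empBellman_apply, empBellman_apply, add_sub_add_left_eq_sub, ← mul_sub, abs_mul,
    abs_of_nonneg h0]
  exact mul_le_mul_of_nonneg_left (abs_vmax_sub_le _ _ _) h0

variable [MeasurableSpace S] [MeasurableSingletonClass S]

omit [Fintype S] [Fintype A] [Nonempty A] [MeasurableSingletonClass S] in
theorem bellman_apply (γ : ℝ) (r : S × A → ℝ) (P : S × A → PMF S) (θ : S × A → ℝ) (sa : S × A) :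
    bellman γ r P θ sa = r sa + γ * ∫ s, vmax θ s ∂(P sa).toMeasure := rfl

omit [Fintype S] [MeasurableSingletonClass S] in
theorem abs_integral_le_of_abs_le {ν : Measure S} [IsProbabilityMeasure ν] {f : S → ℝ} {b : ℝ}
    (h : ∀ s, |f s| ≤ b) : |∫ s, f s ∂ν| ≤ b := by
  simpa using norm_integral_le_of_norm_le_const (μ := ν) (f := f) (C := b)
    (Filter.Eventually.of_forall h)

theorem variance_add_le_two_mul (ν : Measure S) [IsProbabilityMeasure ν] (f g : S → ℝ) :
    Var[fun s => f s + g s; ν] ≤ 2 * Var[f; ν] + 2 * Var[g; ν] := by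
  have hi : ∀ f : S → ℝ, Integrable f ν := fun f => Integrable.of_finite
  have hv : ∀ f : S → ℝ, Var[f; ν] = ∫ s, (f s - ∫ s, f s ∂ν) ^ 2 ∂ν := fun f =>
    variance_eq_integral (Measurable.of_discrete.aemeasurable)
  rw [hv, hv f, hv g, ← integral_const_mul, ← integral_const_mul,
    ← integral_add (hi _) (hi _), integral_add (hi _) (hi _)]
  refine integral_mono (hi _) (hi _) fun s => ?_
  simp only
  nlinarith [sq_nonneg ((f s - ∫ s, f s ∂ν) - (g s - ∫ s, g s ∂ν))]

/-- By Bhatia–Davis the variance is at most `(b - m) * (m + b)`, where `m` is the mean, and either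
factor is at most `2 * b`. -/
theorem integral_add_variance_le {ν : Measure S} [IsProbabilityMeasure ν] {g : S → ℝ} {b : ℝ}
    (hb : 0 < b) (hg : ∀ s, |g s| ≤ b) :
    ∫ s, g s ∂ν + Var[g; ν] / (2 * b) ≤ b ∧ -b ≤ ∫ s, g s ∂ν - Var[g; ν] / (2 * b) := by
  have h := variance_le_sub_mul_sub (μ := ν) (X := g) (a := -b) (b := b)
    (Filter.Eventually.of_forall fun s => abs_le.1 (hg s)) (Measurable.of_discrete.aemeasurable)
  have hm := abs_le.1 (abs_integral_le_of_abs_le (ν := ν) hg)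
  set m := ∫ s, g s ∂ν
  have e : ∀ c, Var[g; ν] ≤ c * (2 * b) → Var[g; ν] / (2 * b) ≤ c := fun c hc =>
    (div_le_iff₀ (by linarith)).2 hc
  have e1 := e (b - m) (by nlinarith)
  have e2 := e (m + b) (by nlinarith)
  constructor <;> linarith

omit [Fintype A] [Nonempty A] in
theorem sigma_sq (γ : ℝ) (r : S × A → ℝ) (P : S × A → PMF S) (θ : S × A → ℝ) (sa : S × A) :
    sigma γ r P θ sa ^ 2 = Var[fun s => γ * vmax θ s; (P sa).toMeasure] := by
  unfold sigma
  rw [Real.sq_sqrt (variance_nonneg _ _)]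
  exact variance_const_add (Measurable.of_discrete.aestronglyMeasurable) _

end Values

/-! ### Deviation of the Monte Carlo Bellman update. -/

section MonteCarlo

variable {S A Ω : Type*} [Fintype S] [MeasurableSpace S]
  [MeasurableSingletonClass S] [Fintype A] [Nonempty A] [MeasurableSpace Ω]
  {μ : Measure Ω} [IsProbabilityMeasure μ] {γ : ℝ} {r : S × A → ℝ} {P : S × A → PMF S}
  {X : ℕ → Ω → S × A → S}

omit [Fintype A] [Nonempty A] [IsProbabilityMeasure μ] in
theorem IsGenerativeSampling.integral_eq (hX : IsGenerativeSampling P μ X) (f : S → ℝ) (i : ℕ)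
    (sa : S × A) : ∫ ω, f (X i ω sa) ∂μ = ∫ s, f s ∂(P sa).toMeasure := by
  rw [← hX.law i sa, integral_map]
  · exact ((measurable_pi_apply sa).comp (hX.measurable i)).aemeasurable
  · exact Measurable.of_discrete.aestronglyMeasurable

omit [Nonempty A] [IsProbabilityMeasure μ] in
theorem IsGenerativeSampling.iIndepFun_apply (hX : IsGenerativeSampling P μ X) (f : S → ℝ)
    (sa : S × A) : iIndepFun (fun i ω => f (X i ω sa)) μ :=
  hX.indep.comp (fun _ x => f (x sa)) fun _ => Measurable.of_discrete

omit [Nonempty A] [IsProbabilityMeasure μ] in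
theorem IsGenerativeSampling.measurable_apply (hX : IsGenerativeSampling P μ X) (f : S → ℝ)
    (i : ℕ) (sa : S × A) : Measurable fun ω => f (X i ω sa) :=
  (Measurable.of_discrete (f := fun x : S × A → S => f (x sa))).comp (hX.measurable i)

omit [Fintype S] [MeasurableSingletonClass S] [Fintype A] [Nonempty A] in
theorem mcBellman_sub_bellman {N : ℕ} (hN : 1 ≤ N) (x : ℕ → S × A → S) (θ : S × A → ℝ)
    (sa : S × A) : mcBellman γ r N x θ sa - bellman γ r P θ sa
      = 1 / (N : ℝ) * ∑ i ∈ Finset.range N,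
          (γ * vmax θ (x i sa) - ∫ s, γ * vmax θ s ∂(P sa).toMeasure) := by
  have hN0 : (N : ℝ) ≠ 0 := by positivity
  rw [bellman_apply, mcBellman, Pi.smul_apply, Finset.sum_apply, smul_eq_mul,
    Finset.sum_sub_distrib, integral_const_mul]
  simp only [empBellman_apply, Finset.sum_add_distrib, Finset.sum_const, Finset.card_range,
    nsmul_eq_mul]
  field_simp
  ring

/-- Bernstein's inequality for the Monte Carlo Bellman update, uniformly over the entries. -/
theorem mcBellman_deviation (h0 : 0 ≤ γ) (h1 : γ ≤ 1) (hX : IsGenerativeSampling P μ X)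
    (θ : S × A → ℝ) {a L : ℝ} {s : S × A → ℝ} {N : ℕ} (ha : 0 < a) (hθ : 2 * ‖θ‖ ≤ a)
    (hs : ∀ sa, 0 ≤ s sa)
    (hv : ∀ sa, Var[fun s => γ * vmax θ s; (P sa).toMeasure] ≤ s sa ^ 2)
    (hL : 0 < L) (hN : 1 ≤ N) :
    μ.real {ω | ∃ sa, 2 * s sa * √(L / N) + a * (L / N)
        < |mcBellman γ r N (fun i => X i ω) θ sa - bellman γ r P θ sa|}
      ≤ Fintype.card S * Fintype.card A * (2 * Real.exp (-L)) := by
  have hset : {ω | ∃ sa, 2 * s sa * √(L / N) + a * (L / N)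
        < |mcBellman γ r N (fun i => X i ω) θ sa - bellman γ r P θ sa|}
      = ⋃ sa, {ω | 2 * s sa * √(L / N) + a * (L / N)
        < |mcBellman γ r N (fun i => X i ω) θ sa - bellman γ r P θ sa|} := by
    ext ω
    simp
  rw [hset]
  refine (measureReal_iUnion_fintype_le _).trans ?_
  have hcard : (Fintype.card S * Fintype.card A : ℝ) * (2 * Real.exp (-L))
      = ∑ _sa : S × A, 2 * Real.exp (-L) := by
    simp [Fintype.card_prod]
  rw [hcard]
  refine Finset.sum_le_sum fun sa _ => ?_
  have hf : ∀ s, |γ * vmax θ s| ≤ ‖θ‖ := fun s => by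
    rw [abs_mul, abs_of_nonneg h0]
    exact (mul_le_of_le_one_left (abs_nonneg _) h1).trans (abs_vmax_le θ s)
  set m := ∫ s, γ * vmax θ s ∂(P sa).toMeasure with hm
  have hmb : |m| ≤ ‖θ‖ := abs_integral_le_of_abs_le hf
  have hv' : ∀ i, ∫ ω, (γ * vmax θ (X i ω sa) - m) ^ 2 ∂μ ≤ s sa ^ 2 := fun i => by
    rw [hX.integral_eq (fun s => (γ * vmax θ s - m) ^ 2)]
    refine le_of_eq_of_le ?_ (hv sa)
    rw [variance_eq_integral Measurable.of_discrete.aemeasurable]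
  have hz : ∀ i, ∫ ω, (γ * vmax θ (X i ω sa) - m) ∂μ = 0 := fun i => by
    rw [hX.integral_eq (fun s => γ * vmax θ s - m), integral_sub Integrable.of_finite
      Integrable.of_finite]
    simp [hm]
  have key := bernstein (μ := μ) (W := fun i ω => γ * vmax θ (X i ω sa) - m) (a := a)
    (s := s sa) (L := L) (N := N) (hX.iIndepFun_apply (fun s => γ * vmax θ s - m) sa)
    (fun i => hX.measurable_apply (fun s => γ * vmax θ s - m) i sa)
    (fun i ω => (abs_sub _ _).trans (by linarith [hf (X i ω sa)])) hz hv' (hs sa) ha hL hN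
  simp only [mcBellman_sub_bellman hN]
  exact key

end MonteCarlo

/-! ### Warm-up step: Monte Carlo value iteration above the noise level. -/

section ValueIteration

/-- The noise of a Monte Carlo value iteration step with effective horizon `h`, in units of the
current error `b`. -/
theorem step_noise_le {h B b w : ℝ} (hh : 1 ≤ h) (hB : 0 < B) (hb1 : B / 2 ≤ b) (hb2 : b ≤ h * B)
    (hwb : w ^ 2 * (256 * h ^ 2 * B) ≤ b) :
    9 / 2 * b * w ^ 2 + 3 * B * w + 4 * h * B * w ^ 2 ≤ b / (2 * h) := by
  have hb : 0 < b := by linarith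
  have h0 : 0 < h := by linarith
  rw [le_div_iff₀ (by positivity)]
  -- In squares: `256 * (h*w*B)^2 ≤ b * B ≤ 2 * b^2`, and `128 ≥ 81`. This is where `B / 2 ≤ b`
  -- enters.
  have e1 : h * w * B ≤ b / 9 := by
    refine abs_le_of_sq_le_sq' ?_ (by positivity) |>.2
    have : (h * w * B) ^ 2 * 256 = w ^ 2 * (256 * h ^ 2 * B) * B := by ring
    nlinarith [mul_le_mul_of_nonneg_right hwb hB.le, mul_le_mul_of_nonneg_left hb1 hb.le]
  have e2 : w ^ 2 * h ≤ 1 / 256 := by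
    have : (w ^ 2 * h) * (h * B) ≤ 1 / 256 * (h * B) := by linarith
    exact le_of_mul_le_mul_right this (by positivity)
  have e3 : h * (h * B * w ^ 2) ≤ b / 256 := by linarith
  have e4 : (w ^ 2 * h) * b ≤ 1 / 256 * b := mul_le_mul_of_nonneg_right e2 hb.le
  linarith

/-- The deviation caused by the current error is `3 * γ * v * w`. By AM-GM `3 * v * w ≤ v^2/(2b) +
9/2 * b * w^2`, and the first summand is paid for by the slack in `hp` and `hp'`. Hence this noise
counts only to second order in `w`. -/
theorem step_error_le {γ b σ v m p ξ B h w : ℝ} (hγ : 0 ≤ γ) (hb : 0 < b)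
    (hp : m + v ^ 2 / (2 * b) ≤ b) (hp' : -b ≤ m - v ^ 2 / (2 * b)) (hw : 0 ≤ w) (hσ : σ ≤ B)
    (hξ : |ξ| ≤ 2 * (3 / 2 * (σ + γ * v)) * w + 4 * h * B * w ^ 2) (he : p = γ * m + ξ) :
    |p| ≤ γ * b + γ * (9 / 2 * b * w ^ 2) + 3 * B * w + 4 * h * B * w ^ 2 := by
  have h1 : 3 * v * w ≤ v ^ 2 / (2 * b) + 9 / 2 * b * w ^ 2 := by
    have : v ^ 2 / (2 * b) + 9 / 2 * b * w ^ 2 - 3 * v * w = (v - 3 * b * w) ^ 2 / (2 * b) := by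
      field_simp; ring
    have : 0 ≤ (v - 3 * b * w) ^ 2 / (2 * b) := by positivity
    linarith
  have h2 := mul_le_mul_of_nonneg_left h1 hγ
  have h3 := mul_le_mul_of_nonneg_left hp hγ
  have h4 := mul_le_mul_of_nonneg_left hp' hγ
  have h5 := mul_le_mul_of_nonneg_right hσ hw
  have h6 := abs_le.1 hξ
  rw [he, abs_le]
  constructor <;> nlinarith

variable {S A Ω : Type*} [Fintype S] [MeasurableSpace S]
  [MeasurableSingletonClass S] [Fintype A] [Nonempty A] [MeasurableSpace Ω]
  {μ : Measure Ω} [IsProbabilityMeasure μ] {γ : ℝ} {r : S × A → ℝ} {P : S × A → PMF S}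
  {θstar : S × A → ℝ}

omit [Fintype A] [Nonempty A] in
theorem bellman_sub_eq (hopt : IsOptimalQ γ r P θstar) (θ : S × A → ℝ) (sa : S × A) :
    bellman γ r P θ sa - θstar sa
      = γ * ∫ s, (vmax θ s - vmax θstar s) ∂(P sa).toMeasure := by
  conv_lhs => rw [← hopt]
  rw [bellman_apply, bellman_apply, integral_sub Integrable.of_finite Integrable.of_finite]
  ring

omit [Fintype S] [MeasurableSingletonClass S] [Fintype A] [Nonempty A] in
theorem sigma_nonneg (γ : ℝ) (r : S × A → ℝ) (P : S × A → PMF S) (θ : S × A → ℝ) (sa : S × A) :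
    0 ≤ sigma γ r P θ sa := Real.sqrt_nonneg _

omit [Fintype A] [Nonempty A] in
theorem variance_vmax_le (γ : ℝ) (r : S × A → ℝ) (P : S × A → PMF S) (θ θstar : S × A → ℝ)
    (sa : S × A) : Var[fun s => γ * vmax θ s; (P sa).toMeasure]
      ≤ 2 * sigma γ r P θstar sa ^ 2
        + 2 * (γ ^ 2 * Var[fun s => vmax θ s - vmax θstar s; (P sa).toMeasure]) := by
  rw [sigma_sq, ← variance_const_mul]
  refine le_of_eq_of_le ?_ (variance_add_le_two_mul (P sa).toMeasure
    (fun s => γ * vmax θstar s) fun s => γ * (vmax θ s - vmax θstar s))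
  congr 1
  funext s
  ring

/-- One step of Monte Carlo value iteration (an epoch of length one) contracts the error, while
the error is above the noise level `B / 2`. -/
theorem reaches_valueIteration_step (h0 : 0 < γ) (h1 : γ < 1) (hopt : IsOptimalQ γ r P θstar)
    {B b L : ℝ} (hB : 0 < B) (hσ : ‖sigma γ r P θstar‖ ≤ B) (hθ : ‖θstar‖ ≤ B / (1 - γ))
    (hb1 : B / 2 ≤ b) (hb2 : b ≤ B / (1 - γ)) (hL : 0 < L) {N : ℕ}
    (hN : 256 * L * B / ((1 - γ) ^ 2 * b) ≤ N) :
    Reaches μ γ r P θstar [(1, N)] b ((1 - (1 - γ) / 4) * b)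
      (Fintype.card S * Fintype.card A * (2 * Real.exp (-L))) := by
  intro θ hθb X hX
  have hb : 0 < b := by linarith
  have hg : 0 < 1 - γ := by linarith
  have hN0 : (0 : ℝ) < N := lt_of_lt_of_le (by positivity) hN
  have hN1 : 1 ≤ N := by exact_mod_cast hN0
  obtain ⟨h, hh⟩ : ∃ h, h = 1 / (1 - γ) := ⟨_, rfl⟩
  have hhg : h * (1 - γ) = 1 := by rw [hh]; field_simp
  have hh1 : 1 ≤ h := by nlinarith
  have hBh : B / (1 - γ) = h * B := by rw [hh]; ring
  rw [hBh] at hθ hb2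
  set V : S × A → ℝ := fun sa => Var[fun s => vmax θ s - vmax θstar s; (P sa).toMeasure] with hV
  have hV0 : ∀ sa, 0 ≤ V sa := fun sa => variance_nonneg _ _
  have hσ0 := sigma_nonneg γ r P θstar
  -- Here `2‖θ‖ ≤ 2(b + ‖θstar‖) ≤ 4hB`. The factor `3/2` comes from `2σ^2 + 2τ^2 ≤ (3/2 * (σ +
  -- τ))^2`.
  have dev := mcBellman_deviation (μ := μ) (r := r) h0.le h1.le hX θ (a := 4 * h * B) (L := L)
    (s := fun sa => 3 / 2 * (sigma γ r P θstar sa + γ * √(V sa))) (N := N)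
    (by positivity) (by
      have : ‖θ‖ ≤ ‖θ - θstar‖ + ‖θstar‖ := by simpa using norm_add_le (θ - θstar) θstar
      linarith)
    (fun sa => by have := hσ0 sa; positivity)
    (fun sa => (variance_vmax_le γ r P θ θstar sa).trans (by
      have e := Real.sq_sqrt (hV0 sa)
      have p : 0 ≤ sigma γ r P θstar sa * (γ * √(V sa)) := by have := hσ0 sa; positivity
      have p2 : 0 ≤ (γ * √(V sa)) ^ 2 := sq_nonneg _
      have p3 := sq_nonneg (sigma γ r P θstar sa)
      have e' : γ ^ 2 * V sa = (γ * √(V sa)) ^ 2 := by rw [mul_pow, e]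
      change 2 * _ + 2 * (γ ^ 2 * V sa) ≤ _
      rw [e']
      nlinarith)) hL hN1
  refine (measureReal_mono ?_ (measure_ne_top _ _)).trans dev
  intro ω hω
  simp only [Set.mem_ofPred_eq] at hω ⊢
  by_contra! hc
  refine absurd hω (not_lt.2 ?_)
  obtain ⟨w, hw⟩ : ∃ w, w = √(L / N) := ⟨_, rfl⟩
  have hw0 : 0 ≤ w := hw ▸ Real.sqrt_nonneg _
  have hw2 : L / N = w ^ 2 := by rw [hw, Real.sq_sqrt (by positivity)]
  have hwb : w ^ 2 * (256 * h ^ 2 * B) ≤ b := by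
    rw [← hw2, div_mul_eq_mul_div, div_le_iff₀ hN0]
    rw [div_le_iff₀ (by positivity)] at hN
    have : L * (256 * h ^ 2 * B) = h ^ 2 * (256 * L * B) := by ring
    rw [this]
    calc h ^ 2 * (256 * L * B) ≤ h ^ 2 * (N * ((1 - γ) ^ 2 * b)) :=
          mul_le_mul_of_nonneg_left hN (by positivity)
      _ = (h * (1 - γ)) ^ 2 * (b * N) := by ring
      _ = b * N := by rw [hhg]; ring
  have hnoise := step_noise_le hh1 hB hb1 hb2 hwb
  have hbh : b / (2 * h) = (1 - γ) * b / 2 := by rw [hh]; field_simp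
  rw [hbh] at hnoise
  rw [pi_norm_le_iff_of_nonneg (mul_nonneg (by linarith) hb.le)]
  intro sa
  set T := mcBellman γ r N (fun i => X i ω) θ with hT
  -- In the only update the iterate is still the recentering point, so the two empirical operators
  -- cancel and leave damped value iteration. As `l ≥ 1/2`, the gain `(1-γ)/2` of the undamped step
  -- becomes at least `(1-γ)/4`.
  obtain ⟨l, hl⟩ : ∃ l, l = 1 / (1 + (1 - γ)) := ⟨_, rfl⟩
  have hl1 : 1 / 2 ≤ l := by
    rw [hl]; exact one_div_le_one_div_of_le (by linarith) (by linarith)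
  have hl2 : l ≤ 1 := by rw [hl, div_le_one (by linarith)]; linarith
  have hrun : runEpochs γ r θ [(1, N)] (fun i => X i ω) sa = (1 - l) * θ sa + l * T sa := by
    simp [runEpochs, runEpoch, epochIter, hl, hT]
  have hsa : |θ sa - θstar sa| ≤ b := (norm_le_pi_norm (θ - θstar) sa).trans hθb
  have hiv := integral_add_variance_le (ν := (P sa).toMeasure) hb
    (g := fun s => vmax θ s - vmax θstar s) fun s => (abs_vmax_sub_le _ _ _).trans hθb
  have hc' := hc sa
  rw [← hw, hw2] at hc'
  have hstep := step_error_le (p := T sa - θstar sa) (v := √(V sa)) h0.le hb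
    (by rw [Real.sq_sqrt (hV0 sa)]; exact hiv.1) (by rw [Real.sq_sqrt (hV0 sa)]; exact hiv.2) hw0
    ((le_abs_self _).trans ((norm_le_pi_norm _ sa).trans hσ)) hc'
    (by rw [← bellman_sub_eq hopt]; ring)
  have hgb : γ * (9 / 2 * b * w ^ 2) ≤ 9 / 2 * b * w ^ 2 :=
    mul_le_of_le_one_left (by positivity) h1.le
  have hTb : |T sa - θstar sa| ≤ b - (1 - γ) * b / 2 := by linarith
  rw [Pi.sub_apply, hrun, Real.norm_eq_abs]
  have e : (1 - l) * θ sa + l * T sa - θstar sa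
      = (1 - l) * (θ sa - θstar sa) + l * (T sa - θstar sa) := by ring
  rw [e]
  refine (abs_add_le _ _).trans ?_
  rw [abs_mul, abs_mul, abs_of_nonneg (by linarith : 0 ≤ 1 - l),
    abs_of_nonneg (by linarith : 0 ≤ l)]
  have k1 := mul_le_mul_of_nonneg_left hsa (by linarith : 0 ≤ 1 - l)
  have k2 := mul_le_mul_of_nonneg_left hTb (by linarith : 0 ≤ l)
  have k3 := mul_le_mul_of_nonneg_right hl1 (by positivity : 0 ≤ (1 - γ) * b / 2)
  linarith

end ValueIteration

/-! ### One variance-reduced epoch halves the error. -/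

section VarianceReduction

theorem sum_inv_sqrt_le {h : ℝ} (hh : 1 ≤ h) (k : ℕ) :
    ∑ j ∈ Finset.range k, 1 / √((j : ℝ) + h) ≤ 2 * √((k : ℝ) + h - 1) := by
  induction k with
  | zero => simp
  | succ k ih =>
    rw [Finset.sum_range_succ]
    have hk : (0 : ℝ) ≤ k := k.cast_nonneg
    push_cast
    rw [show (k : ℝ) + 1 + h - 1 = k + h by ring]
    have hx : 0 < √((k : ℝ) + h) := Real.sqrt_pos.2 (by linarith)
    have e1 := Real.sq_sqrt (by linarith : 0 ≤ (k : ℝ) + h)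
    have e2 := Real.sq_sqrt (by linarith : 0 ≤ (k : ℝ) + h - 1)
    have : 1 / √((k : ℝ) + h) ≤ 2 * √((k : ℝ) + h) - 2 * √((k : ℝ) + h - 1) := by
      rw [div_le_iff₀ hx]
      nlinarith [sq_nonneg (√((k : ℝ) + h) - √((k : ℝ) + h - 1))]
    linarith

/-- The step size of update number `k + 1` of an epoch. -/
noncomputable def stepSize (γ : ℝ) (k : ℕ) : ℝ := 1 / (1 + (1 - γ) * ((k : ℝ) + 1))

theorem stepSize_pos {γ : ℝ} (h1 : γ < 1) (k : ℕ) : 0 < stepSize γ k := by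
  have : 0 < 1 - γ := by linarith
  unfold stepSize
  positivity

theorem stepSize_le_one {γ : ℝ} (h1 : γ < 1) (k : ℕ) : stepSize γ k ≤ 1 := by
  have : 0 < 1 - γ := by linarith
  unfold stepSize
  rw [div_le_one (by positivity)]
  have : 0 ≤ (1 - γ) * ((k : ℝ) + 1) := by positivity
  linarith

theorem stepSize_eq {γ h : ℝ} (hh : 1 ≤ h) (hg : h * (1 - γ) = 1) (k : ℕ) :
    stepSize γ k = h / ((k : ℝ) + 1 + h) := by
  have hk : (0 : ℝ) ≤ k := k.cast_nonneg
  have h0 : h ≠ 0 := by linarith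
  have : 1 - γ = 1 / h := by field_simp; linarith
  rw [stepSize, this]
  field_simp
  ring

variable {S A Ω : Type*} [Fintype S] [MeasurableSpace S]
  [MeasurableSingletonClass S] [Fintype A] [Nonempty A] [MeasurableSpace Ω]
  {μ : Measure Ω} [IsProbabilityMeasure μ] {γ : ℝ} {r : S × A → ℝ} {P : S × A → PMF S}
  {θstar : S × A → ℝ}

/-- The centred noise of the variance-reduced update at `θstar`, recentred at `θbar`, as a
function of the next state. -/
noncomputable def recenteredNoise {S A : Type*} [MeasurableSpace S] (γ : ℝ) (P : S × A → PMF S)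
    (θstar θbar : S × A → ℝ) (sa : S × A) (s : S) : ℝ :=
  γ * (vmax θstar s - vmax θbar s)
    - ∫ s, γ * (vmax θstar s - vmax θbar s) ∂(P sa).toMeasure

/-- The running average of the recentred noise along an epoch. -/
noncomputable def noiseAvg {S A : Type*} [MeasurableSpace S] (γ : ℝ) (P : S × A → PMF S)
    (θstar θbar : S × A → ℝ) (x : ℕ → S × A → S) (k : ℕ) (sa : S × A) : ℝ :=
  ∑ j ∈ Finset.range k, avgWeight (stepSize γ) k j * recenteredNoise γ P θstar θbar sa (x j sa)

/-- Removing the linear noise average leaves a remainder driven only by the `γ`-contraction and the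
recentering error. If `u` bounds it, the next bound is `(1-l)*u + l*(γ*(u + p k) + v)`. Since `l *
(k+1+h) = h` and `h * (1-γ) = 1`, multiplying by `k+1+h` gives at most `(k+h)*u + h*(p k + v)`, and
this telescopes. -/
theorem epochIter_sub_noiseAvg_le (h0 : 0 < γ) (h1 : γ < 1) (hopt : IsOptimalQ γ r P θstar)
    {h : ℝ} (hh : h = 1 / (1 - γ)) {θbar Tbar : S × A → ℝ} {x : ℕ → S × A → S} {K : ℕ} {b v : ℝ}
    {p : ℕ → ℝ} (hb : ‖θbar - θstar‖ ≤ b) (hp0 : ∀ k, 0 ≤ p k)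
    (hv : ∀ sa, |Tbar sa - bellman γ r P θbar sa| ≤ v)
    (hp : ∀ k < K, ∀ sa, |noiseAvg γ P θstar θbar x k sa| ≤ p k) :
    ∀ k ≤ K, ∀ sa, |epochIter γ r θbar Tbar x k sa - θstar sa
        - noiseAvg γ P θstar θbar x k sa| * ((k : ℝ) + h)
      ≤ h * b + h * ∑ j ∈ Finset.range k, (p j + v) := by
  have hg : 0 < 1 - γ := by linarith
  have hhg : h * (1 - γ) = 1 := by rw [hh]; field_simp
  have hh1 : 1 ≤ h := by nlinarith
  have hb0 : 0 ≤ b := (norm_nonneg _).trans hb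
  intro k
  induction k with
  | zero =>
    intro _ sa
    have := (norm_le_pi_norm (θbar - θstar) sa).trans hb
    rw [Pi.sub_apply, Real.norm_eq_abs] at this
    simp only [epochIter, noiseAvg, Finset.range_zero, Finset.sum_empty, sub_zero,
      Nat.cast_zero, zero_add, mul_zero, add_zero]
    nlinarith
  | succ k ih =>
    intro hk sa
    have hk0 : (0 : ℝ) ≤ k := k.cast_nonneg
    have ih' := ih (by omega)
    set R := h * b + h * ∑ j ∈ Finset.range k, (p j + v) with hR
    have hkh : 0 < (k : ℝ) + h := by linarith
    obtain ⟨u, hu⟩ : ∃ u, u = R / ((k : ℝ) + h) := ⟨_, rfl⟩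
    have hRu : R = u * ((k : ℝ) + h) := by rw [hu]; field_simp
    have hU : ∀ sa, |epochIter γ r θbar Tbar x k sa - θstar sa
        - noiseAvg γ P θstar θbar x k sa| ≤ u := fun sa => by
      rw [hu, le_div_iff₀ hkh]; exact ih' sa
    have hu0 : 0 ≤ u := (abs_nonneg _).trans (hU sa)
    have hΔ : ‖epochIter γ r θbar Tbar x k - θstar‖ ≤ u + p k := by
      rw [pi_norm_le_iff_of_nonneg (add_nonneg hu0 (hp0 k))]
      intro sa
      have a1 := abs_le.1 (hU sa)
      have a2 := abs_le.1 (hp k (by omega) sa)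
      rw [Pi.sub_apply, Real.norm_eq_abs, abs_le]
      constructor <;> linarith
    set l := stepSize γ k with hl
    have hl0 : 0 < l := stepSize_pos h1 k
    have hl1 : l ≤ 1 := stepSize_le_one h1 k
    have hN : noiseAvg γ P θstar θbar x (k + 1) sa = (1 - l) * noiseAvg γ P θstar θbar x k sa
        + l * recenteredNoise γ P θstar θbar sa (x k sa) :=
      sum_avgWeight_succ _ (fun j => recenteredNoise γ P θstar θbar sa (x j sa)) k
    have hE : epochIter γ r θbar Tbar x (k + 1) sa = (1 - l) * epochIter γ r θbar Tbar x k sa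
        + l * (empBellman γ r (x k) (epochIter γ r θbar Tbar x k) sa
          - empBellman γ r (x k) θbar sa + Tbar sa) := rfl
    -- The fixed-point equation identifies this difference with the mean subtracted in
    -- `recenteredNoise`, so no bias remains in `key`.
    have hd : θstar sa - bellman γ r P θbar sa
        = ∫ s, γ * (vmax θstar s - vmax θbar s) ∂(P sa).toMeasure := by
      have e := bellman_sub_eq hopt θbar sa
      rw [integral_sub Integrable.of_finite Integrable.of_finite] at e
      rw [integral_const_mul, integral_sub Integrable.of_finite Integrable.of_finite]
      linarith
    have key : epochIter γ r θbar Tbar x (k + 1) sa - θstar sa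
          - noiseAvg γ P θstar θbar x (k + 1) sa
        = (1 - l) * (epochIter γ r θbar Tbar x k sa - θstar sa
            - noiseAvg γ P θstar θbar x k sa)
          + l * ((empBellman γ r (x k) (epochIter γ r θbar Tbar x k) sa
            - empBellman γ r (x k) θstar sa) + (Tbar sa - bellman γ r P θbar sa)) := by
      rw [hN, hE, recenteredNoise, ← hd]
      simp only [empBellman_apply]
      ring
    have hc := (abs_empBellman_sub_le h0.le r (x k) (epochIter γ r θbar Tbar x k) θstar sa).trans
      (mul_le_mul_of_nonneg_left hΔ h0.le)
    have hstep : |epochIter γ r θbar Tbar x (k + 1) sa - θstar sa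
        - noiseAvg γ P θstar θbar x (k + 1) sa| ≤ (1 - l) * u + l * (γ * (u + p k) + v) := by
      rw [key]
      refine (abs_add_le _ _).trans ?_
      rw [abs_mul, abs_mul, abs_of_nonneg (by linarith : 0 ≤ 1 - l), abs_of_pos hl0]
      refine add_le_add (mul_le_mul_of_nonneg_left (hU sa) (by linarith))
        (mul_le_mul_of_nonneg_left ((abs_add_le _ _).trans (add_le_add hc (hv sa))) hl0.le)
    have hlk : l * ((k : ℝ) + 1 + h) = h := by
      rw [hl, stepSize_eq hh1 hhg]; field_simp
    rw [Finset.sum_range_succ, mul_add h, ← add_assoc, ← hR, hRu]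
    push_cast
    refine (mul_le_mul_of_nonneg_right hstep (by linarith)).trans ?_
    have e : ((1 - l) * u + l * (γ * (u + p k) + v)) * ((k : ℝ) + 1 + h)
        = u * ((k : ℝ) + 1 + h) + (l * ((k : ℝ) + 1 + h)) * (γ * p k + v - (1 - γ) * u) := by ring
    rw [e, hlk]
    have : γ * p k ≤ p k := mul_le_of_le_one_left (hp0 k) h1.le
    have : h * (γ * p k) ≤ h * p k := mul_le_mul_of_nonneg_left this (by linarith)
    have e2 : h * ((1 - γ) * u) = u := by rw [← mul_assoc, hhg, one_mul]
    linarith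

/-- Each noise term comes from a variable in `[-b, b]`, so Hoeffding's lemma gives proxy `b^2`. The
squared weights sum to at most `h/(k+h)`, and the threshold makes the tail exponent exactly `L`. -/
theorem noiseAvg_deviation (h0 : 0 < γ) (h1 : γ < 1) {h : ℝ} (hh : h = 1 / (1 - γ))
    {X : ℕ → Ω → S × A → S}
    (hX : IsGenerativeSampling P μ X) {θbar : S × A → ℝ} {b L : ℝ} (hb : 0 < b)
    (hθ : ‖θbar - θstar‖ ≤ b) (hL : 0 < L) (k : ℕ) :
    μ.real {ω | ∃ sa, b * √(2 * h * L) * (1 / √((k : ℝ) + h))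
        < |noiseAvg γ P θstar θbar (fun i => X i ω) k sa|}
      ≤ Fintype.card S * Fintype.card A * (2 * Real.exp (-L)) := by
  have hg : 0 < 1 - γ := by linarith
  have hhg : h * (1 - γ) = 1 := by rw [hh]; field_simp
  have hh1 : 1 ≤ h := by nlinarith
  have hk0 : (0 : ℝ) ≤ k := k.cast_nonneg
  have hset : {ω | ∃ sa, b * √(2 * h * L) * (1 / √((k : ℝ) + h))
        < |noiseAvg γ P θstar θbar (fun i => X i ω) k sa|}
      = ⋃ sa, {ω | b * √(2 * h * L) * (1 / √((k : ℝ) + h))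
        < |noiseAvg γ P θstar θbar (fun i => X i ω) k sa|} := by
    ext ω
    simp
  rw [hset]
  refine (measureReal_iUnion_fintype_le _).trans ?_
  have hcard : (Fintype.card S * Fintype.card A : ℝ) * (2 * Real.exp (-L))
      = ∑ _sa : S × A, 2 * Real.exp (-L) := by
    simp [Fintype.card_prod]
  rw [hcard]
  refine Finset.sum_le_sum fun sa _ => ?_
  obtain ⟨c, rfl⟩ : ∃ c : NNReal, (c : ℝ) = b := ⟨⟨b, hb.le⟩, rfl⟩
  have hd : ∀ s, |γ * (vmax θstar s - vmax θbar s)| ≤ c := fun s => by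
    rw [abs_mul, abs_of_pos h0]
    refine (mul_le_of_le_one_left (abs_nonneg _) h1.le).trans ((abs_vmax_sub_le _ _ s).trans ?_)
    rwa [norm_sub_rev]
  have hsub : ∀ i, HasSubgaussianMGF
      (fun ω => recenteredNoise γ P θstar θbar sa (X i ω sa)) (c ^ 2) μ := fun i => by
    have := hasSubgaussianMGF_of_mem_Icc (μ := μ)
      (X := fun ω => γ * (vmax θstar (X i ω sa) - vmax θbar (X i ω sa)))
      (a := -(c : ℝ)) (b := c)
      (hX.measurable_apply (fun s => γ * (vmax θstar s - vmax θbar s)) i sa).aemeasurable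
      (Filter.Eventually.of_forall fun ω => abs_le.1 (hd _))
    rw [hX.integral_eq (fun s => γ * (vmax θstar s - vmax θbar s))] at this
    have e : ‖(c : ℝ) - -(c : ℝ)‖₊ = 2 * c := by
      ext
      rw [coe_nnnorm, Real.norm_eq_abs, sub_neg_eq_add, ← two_mul]
      simp
    rw [e, mul_div_cancel_left₀ c two_ne_zero] at this
    exact this
  have hw : (∑ j ∈ Finset.range k, avgWeight (stepSize γ) k j ^ 2) * ((c ^ 2 : NNReal) : ℝ)
      ≤ h / ((k : ℝ) + h) * c ^ 2 := by
    push_cast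
    refine mul_le_mul_of_nonneg_right ?_ (by positivity)
    cases k with
    | zero => simp; positivity
    | succ k =>
      have hk0' : (0 : ℝ) ≤ k := k.cast_nonneg
      -- The condition on consecutive step sizes reduces to `k + 2 ≤ k + 1 + h`, that is, `h ≥ 1`.
      have := sum_avgWeight_sq_le (l := stepSize γ) (fun k => (stepSize_pos h1 k).le)
        (fun k => stepSize_le_one h1 k) (fun k => by
          have hk0 : (0 : ℝ) ≤ k := k.cast_nonneg
          rw [stepSize_eq hh1 hhg, stepSize_eq hh1 hhg]
          push_cast
          rw [one_sub_div (by positivity), div_mul_div_comm, div_le_div_iff₀ (by positivity)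
            (by positivity)]
          have : 0 ≤ h * ((k : ℝ) + 1 + 1 + h) * (h - 1) :=
            mul_nonneg (by positivity) (by linarith)
          nlinarith) k
      rw [stepSize_eq hh1 hhg] at this
      push_cast
      exact this
  have key := subgaussian_abs (μ := μ) (hX.iIndepFun_apply (recenteredNoise γ P θstar θbar sa) sa)
    hsub (avgWeight (stepSize γ) k) k (v := h / ((k : ℝ) + h) * c ^ 2)
    (x := c * √(2 * h * L) * (1 / √((k : ℝ) + h))) (by positivity) hw (by positivity)
  refine key.trans_eq ?_
  congr 2
  rw [mul_pow, mul_pow, div_pow, Real.sq_sqrt (by positivity), Real.sq_sqrt (by positivity)]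
  field_simp

/-- Since `1152 = 2 * 24^2`, the length gives `h * √(2hL) ≤ √G / 24`. The budget, in units of `b`,
is `1/1152` for the initial error, `1/12` for the accumulated noise, `1/4` for recentering and
`1/24` for the final noise. -/
theorem epoch_error_le {h b L v Δ G : ℝ} {K : ℕ} (hh : 1 ≤ h) (hb : 0 < b) (hL : 1 ≤ L)
    (hv : h * v ≤ b / 4) (hK : 1152 * h ^ 3 * L ≤ K) (hG : G = K + h)
    (hΔ : Δ * G ≤ h * b + h * ∑ j ∈ Finset.range K,
      (b * √(2 * h * L) * (1 / √((j : ℝ) + h)) + v)) :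
    Δ + b * √(2 * h * L) * (1 / √G) ≤ b / 2 := by
  have hG0 : 0 < G := by rw [hG]; positivity
  obtain ⟨w, hw⟩ : ∃ w, w = √G := ⟨_, rfl⟩
  obtain ⟨s, hs⟩ : ∃ s, s = √(2 * h * L) := ⟨_, rfl⟩
  have hw0 : 0 < w := hw ▸ Real.sqrt_pos.2 hG0
  have hs0 : 0 ≤ s := hs ▸ Real.sqrt_nonneg _
  have hw2 : G = w ^ 2 := by rw [hw, Real.sq_sqrt hG0.le]
  have hs2 : s ^ 2 = 2 * h * L := by rw [hs, Real.sq_sqrt (by positivity)]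
  have hsum := sum_inv_sqrt_le hh K
  have hmono : √((K : ℝ) + h - 1) ≤ w := by
    rw [hw]; exact Real.sqrt_le_sqrt (by rw [hG]; linarith)
  rw [Finset.sum_add_distrib, ← Finset.mul_sum, Finset.sum_const, Finset.card_range,
    nsmul_eq_mul, ← hs] at hΔ
  rw [← hs, ← hw]
  have hKG : (K : ℝ) ≤ w ^ 2 := by rw [← hw2, hG]; linarith
  have hsw : h * s ≤ w / 24 := by
    refine (abs_le_of_sq_le_sq' ?_ (by positivity)).2
    rw [mul_pow, hs2]
    nlinarith
  have hhw : h ≤ w ^ 2 / 1152 := by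
    have : h ^ 3 * L ≥ h := by
      have : h ^ 2 ≥ 1 := one_le_pow₀ hh
      have : h ^ 2 * L ≥ 1 := one_le_mul_of_one_le_of_one_le this hL
      nlinarith
    linarith
  have hsw1 : s ≤ w / 24 := by nlinarith
  have hp : b * s * (1 / w) ≤ b / 24 := by
    rw [mul_one_div, div_le_iff₀ hw0]
    nlinarith
  have h3 : h * (b * s * ∑ j ∈ Finset.range K, 1 / √((j : ℝ) + h)) ≤ b / 12 * w ^ 2 := by
    calc _ ≤ h * (b * s * (2 * w)) := by gcongr; linarith
      _ = 2 * b * w * (h * s) := by ring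
      _ ≤ 2 * b * w * (w / 24) := by gcongr
      _ = _ := by ring
  have h4 : h * (K * v) ≤ b / 4 * w ^ 2 := by
    calc _ = (h * v) * K := by ring
      _ ≤ b / 4 * w ^ 2 := by gcongr
  have h5 : h * b ≤ b / 1152 * w ^ 2 := by nlinarith
  have : Δ * w ^ 2 ≤ (b / 1152 + b / 12 + b / 4) * w ^ 2 := by
    rw [← hw2] at *
    linarith
  have := le_of_mul_le_mul_right this (by positivity)
  linarith

/-- One epoch of variance-reduced Q-learning halves the error. -/
theorem reaches_varianceReduced_epoch (h0 : 0 < γ) (h1 : γ < 1) (hopt : IsOptimalQ γ r P θstar)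
    {B b L L' : ℝ} (hσ : ‖sigma γ r P θstar‖ ≤ B) (hθ : ‖θstar‖ ≤ B / (1 - γ)) (hb : 0 < b)
    (hbB : b ≤ B) (hL : 0 < L) (hL' : 1 ≤ L') {K N : ℕ}
    (hK : 1152 * L' / (1 - γ) ^ 3 ≤ K) (hN : 1024 * L * B ^ 2 / ((1 - γ) ^ 2 * b ^ 2) ≤ N) :
    Reaches μ γ r P θstar [(K, N)] b (b / 2)
      (Fintype.card S * Fintype.card A * (2 * Real.exp (-L))
        + (K + 1) * (Fintype.card S * Fintype.card A * (2 * Real.exp (-L')))) := by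
  intro θ hθb X hX
  have hB : 0 < B := by linarith
  have hg : 0 < 1 - γ := by linarith
  have hN0 : (0 : ℝ) < N := lt_of_lt_of_le (by positivity) hN
  have hN1 : 1 ≤ N := by exact_mod_cast hN0
  obtain ⟨h, hh⟩ : ∃ h, h = 1 / (1 - γ) := ⟨_, rfl⟩
  have hhg : h * (1 - γ) = 1 := by rw [hh]; field_simp
  have hh1 : 1 ≤ h := by nlinarith
  rw [show B / (1 - γ) = h * B by rw [hh]; ring] at hθ
  have hK' : 1152 * h ^ 3 * L' ≤ K := by
    refine le_of_eq_of_le ?_ hK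
    rw [hh]; field_simp
  -- The standard deviation `2 * B` suffices because `b ≤ B`: the variance is at most `2B^2 + 2B^2`.
  have dev := mcBellman_deviation (μ := μ) (r := r) h0.le h1.le hX θ (a := 4 * h * B) (L := L)
    (s := fun _ => 2 * B) (N := N) (by positivity) (by
      have : ‖θ‖ ≤ ‖θ - θstar‖ + ‖θstar‖ := by simpa using norm_add_le (θ - θstar) θstar
      nlinarith)
    (fun sa => by positivity)
    (fun sa => (variance_vmax_le γ r P θ θstar sa).trans (by
      have e1 : sigma γ r P θstar sa ^ 2 ≤ B ^ 2 :=
        pow_le_pow_left₀ (sigma_nonneg _ _ _ _ _)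
          ((le_abs_self _).trans ((norm_le_pi_norm _ sa).trans hσ)) 2
      have e2 := variance_le_sq_of_bounded (μ := (P sa).toMeasure)
        (X := fun s => vmax θ s - vmax θstar s) (a := -b) (b := b)
        (Filter.Eventually.of_forall fun s => abs_le.1 ((abs_vmax_sub_le _ _ s).trans hθb))
        Measurable.of_discrete.aemeasurable
      have e3 : ((b - -b) / 2) ^ 2 ≤ B ^ 2 := by
        rw [show (b - -b) / 2 = b by ring]
        exact pow_le_pow_left₀ hb.le hbB 2
      have e4 : γ ^ 2 * Var[fun s => vmax θ s - vmax θstar s; (P sa).toMeasure] ≤ B ^ 2 :=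
        (mul_le_of_le_one_left (variance_nonneg _ _) (pow_le_one₀ h0.le h1.le)).trans
          (e2.trans e3)
      nlinarith)) hL hN1
  -- Times `0, …, K-1` feed the recursion; time `K` is needed to add the noise back at the end.
  have hnoise : μ.real (⋃ k ∈ Finset.range (K + 1), {ω | ∃ sa,
      b * √(2 * h * L') * (1 / √((k : ℝ) + h))
        < |noiseAvg γ P θstar θ (fun i => X (N + i) ω) k sa|})
      ≤ (K + 1) * (Fintype.card S * Fintype.card A * (2 * Real.exp (-L'))) := by
    refine (measureReal_biUnion_finset_le _ _).trans ((Finset.sum_le_sum fun k _ =>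
      noiseAvg_deviation h0 h1 hh (hX.shift N) hb hθb (by linarith) k).trans_eq ?_)
    simp
  refine (measureReal_mono ?_ (measure_ne_top _ _)).trans
    ((measureReal_union_le _ _).trans (add_le_add dev hnoise))
  intro ω hω
  by_contra hc
  simp only [Set.mem_union, Set.mem_iUnion, Set.mem_ofPred_eq, not_or, not_exists, not_lt,
    Finset.mem_range] at hc hω
  obtain ⟨hc1, hc2⟩ := hc
  refine absurd hω (not_lt.2 ?_)
  obtain ⟨w, hw⟩ : ∃ w, w = √(L / N) := ⟨_, rfl⟩
  have hw0 : 0 ≤ w := hw ▸ Real.sqrt_nonneg _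
  have hw2 : L / N = w ^ 2 := by rw [hw, Real.sq_sqrt (by positivity)]
  rw [← hw, hw2] at hc1
  have hwb : 32 * h * B * w ≤ b := by
    refine (abs_le_of_sq_le_sq' ?_ hb.le).2
    have e : (32 * h * B * w) ^ 2 = 1024 * h ^ 2 * B ^ 2 * (L / N) := by rw [hw2]; ring
    rw [e, mul_div_assoc', div_le_iff₀ hN0]
    rw [div_le_iff₀ (by positivity)] at hN
    calc 1024 * h ^ 2 * B ^ 2 * L = h ^ 2 * (1024 * L * B ^ 2) := by ring
      _ ≤ h ^ 2 * (N * ((1 - γ) ^ 2 * b ^ 2)) := by gcongr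
      _ = (h * (1 - γ)) ^ 2 * (b ^ 2 * N) := by ring
      _ = b ^ 2 * N := by rw [hhg]; ring
  have hv : h * (2 * (2 * B) * w + 4 * h * B * w ^ 2) ≤ b / 4 := by
    have e1 : h * (2 * (2 * B) * w) ≤ b / 8 := by nlinarith
    have e2 : (h * w) * 32 ≤ 1 := by
      have : (h * w * 32) * B ≤ 1 * B := by nlinarith
      exact le_of_mul_le_mul_right this hB
    have e3 : h * (4 * h * B * w ^ 2) ≤ b / 8 := by
      have : h * (4 * h * B * w ^ 2) = (32 * h * B * w) * (h * w) / 8 := by ring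
      rw [this]
      have : (32 * h * B * w) * (h * w) ≤ b * 1 :=
        mul_le_mul hwb (by nlinarith) (by positivity) hb.le
      linarith
    linarith
  rw [pi_norm_le_iff_of_nonneg (by positivity)]
  intro sa
  have hp : ∀ k < K + 1, ∀ sa, |noiseAvg γ P θstar θ (fun i => X (N + i) ω) k sa|
      ≤ b * √(2 * h * L') * (1 / √((k : ℝ) + h)) := fun k hk sa => hc2 k hk sa
  have hrec := epochIter_sub_noiseAvg_le (x := fun i => X (N + i) ω) (K := K) h0 h1 hopt hh hθb
    (v := 2 * (2 * B) * w + 4 * h * B * w ^ 2) (fun k => by positivity) hc1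
    (fun k hk => hp k (by omega)) K le_rfl sa
  have fin := epoch_error_le hh1 hb hL' hv hK' rfl hrec
  have hpK := hp K (by omega) sa
  change |epochIter γ r θ (mcBellman γ r N (fun i => X i ω) θ) (fun i => X (N + i) ω) K sa
    - θstar sa| ≤ b / 2
  set e := epochIter γ r θ (mcBellman γ r N (fun i => X i ω) θ) (fun i => X (N + i) ω) K sa
    - θstar sa
  set n := noiseAvg γ P θstar θ (fun i => X (N + i) ω) K sa
  calc |e| = |(e - n) + n| := by ring_nf
    _ ≤ |e - n| + |n| := abs_add_le _ _
    _ ≤ _ := (add_le_add_right hpK _).trans fin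

end VarianceReduction

/-! ### The plan: cost, accuracy and failure probability of its two phases. -/

section Plan

theorem totalSamples_map_range (n : ℕ) (e : ℕ → ℕ × ℕ) :
    totalSamples ((List.range n).map e) = ∑ i ∈ Finset.range n, ((e i).1 + (e i).2) := by
  induction n with
  | zero => rfl
  | succ n ih =>
    rw [List.range_succ, List.map_append, totalSamples_append, ih, Finset.sum_range_succ]
    simp [totalSamples]

/-- The error contraction factor of a warm-up step. -/
noncomputable def warmupFactor (γ : ℝ) : ℝ := 1 - (1 - γ) / 4

/-- The number of warm-up steps. -/
noncomputable def warmupLength (γ : ℝ) : ℕ := sInf {n | warmupFactor γ ^ n ≤ (1 - γ) / 2}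

/-- The warm-up: value iteration steps (epochs of length one) with growing sample sizes, where
`L` is the logarithmic factor. -/
noncomputable def warmupPlan (γ L : ℝ) : List (ℕ × ℕ) :=
  (List.range (warmupLength γ)).map fun j =>
    (1, ⌈2560 * L / ((1 - γ) * warmupFactor γ ^ j)⌉₊)

/-- The refinement: `k` epochs of fixed length with recentering sizes growing by factors of `4`,
where `L` and `L'` are the logarithmic factors. -/
noncomputable def refinementPlan (γ L L' : ℝ) (k : ℕ) : List (ℕ × ℕ) :=
  (List.range k).map fun m =>
    (⌈11520 * L / (1 - γ) ^ 3⌉₊, ⌈1024 * 4 ^ (m + 1) * L' / (1 - γ) ^ 2⌉₊)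

/-- The plan of variance-reduced Q-learning: the warm-up followed by `M - 1` epochs. -/
noncomputable def vrPlan (γ δ : ℝ) (D M : ℕ) : List (ℕ × ℕ) :=
  warmupPlan γ (Real.log (8 * M * D / ((1 - γ) * δ))) ++
    refinementPlan γ (Real.log (8 * M * D / ((1 - γ) * δ))) (Real.log (8 * M * D / δ)) (M - 1)

variable {γ : ℝ}

theorem warmupFactor_pos (h0 : 0 < γ) : 0 < warmupFactor γ := by
  unfold warmupFactor; linarith

theorem warmupFactor_lt_one (h1 : γ < 1) : warmupFactor γ < 1 := by
  unfold warmupFactor; linarith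

theorem warmupFactor_pow_warmupLength_le (h1 : γ < 1) :
    warmupFactor γ ^ warmupLength γ ≤ (1 - γ) / 2 := by
  obtain ⟨n, hn⟩ := exists_pow_lt_of_lt_one (by linarith : 0 < (1 - γ) / 2)
    (warmupFactor_lt_one h1)
  have hne : {n | warmupFactor γ ^ n ≤ (1 - γ) / 2}.Nonempty := ⟨n, hn.le⟩
  have := Nat.sInf_mem hne
  exact this

theorem lt_warmupFactor_pow {j : ℕ} (hj : j < warmupLength γ) :
    (1 - γ) / 2 < warmupFactor γ ^ j :=
  not_le.1 fun h => absurd (Nat.sInf_le (s := {n | warmupFactor γ ^ n ≤ (1 - γ) / 2}) h)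
    (not_le.2 hj)

theorem sum_inv_warmupFactor_pow_succ_le (h0 : 0 < γ) (h1 : γ < 1) (n : ℕ) :
    ∑ j ∈ Finset.range (n + 1), 1 / warmupFactor γ ^ j
      ≤ 4 / (1 - γ) * (1 / warmupFactor γ ^ n) := by
  have hg : 0 < 1 - γ := by linarith
  have hρ := warmupFactor_pos h0
  induction n with
  | zero =>
    simp only [zero_add, Finset.range_one, Finset.sum_singleton, pow_zero, div_one, mul_one]
    rw [le_div_iff₀ hg]
    linarith
  | succ n ih =>
    rw [Finset.sum_range_succ]
    refine (add_le_add_left ih _).trans_eq ?_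
    have : warmupFactor γ * 4 = 4 - (1 - γ) := by unfold warmupFactor; ring
    rw [pow_succ]
    field_simp
    linarith

/-- The geometric sum is dominated by its last term, which is at most `2/(1-γ)` because
`warmupLength` is minimal. So the length of the warm-up adds no logarithmic factor to its cost. -/
theorem sum_inv_warmupFactor_pow_le (h0 : 0 < γ) (h1 : γ < 1) :
    ∑ j ∈ Finset.range (warmupLength γ), 1 / warmupFactor γ ^ j ≤ 8 / (1 - γ) ^ 2 := by
  have hg : 0 < 1 - γ := by linarith
  cases hn : warmupLength γ with
  | zero => simp; positivity
  | succ n =>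
    refine (sum_inv_warmupFactor_pow_succ_le h0 h1 n).trans ?_
    have h := lt_warmupFactor_pow (γ := γ) (j := n) (by omega)
    have : 1 / warmupFactor γ ^ n ≤ 2 / (1 - γ) := by
      rw [div_le_div_iff₀ (by linarith) hg]
      linarith
    calc _ ≤ 4 / (1 - γ) * (2 / (1 - γ)) := by gcongr
      _ = _ := by field_simp; norm_num

/-- Crude, as every term of the previous sum is at least one; it serves only the union bound over
failures. -/
theorem warmupLength_le (h0 : 0 < γ) (h1 : γ < 1) : (warmupLength γ : ℝ) ≤ 8 / (1 - γ) ^ 2 := by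
  refine le_trans ?_ (sum_inv_warmupFactor_pow_le h0 h1)
  have : (warmupLength γ : ℝ) = ∑ _j ∈ Finset.range (warmupLength γ), (1 : ℝ) := by simp
  rw [this]
  refine Finset.sum_le_sum fun j _ => ?_
  rw [le_div_iff₀ (pow_pos (warmupFactor_pos h0) j), one_mul]
  exact pow_le_one₀ (warmupFactor_pos h0).le (warmupFactor_lt_one h1).le

theorem totalSamples_warmupPlan_le (h0 : 0 < γ) (h1 : γ < 1) {L : ℝ} (hL : 1 ≤ L) :
    (totalSamples (warmupPlan γ L) : ℝ) ≤ 20496 * (L / (1 - γ) ^ 3) := by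
  have hg : 0 < 1 - γ := by linarith
  have hρ := warmupFactor_pos h0
  have hh : 1 ≤ L / (1 - γ) := by rw [le_div_iff₀ hg]; linarith
  rw [warmupPlan, totalSamples_map_range]
  push_cast
  calc _ ≤ ∑ j ∈ Finset.range (warmupLength γ),
        2562 * (L / (1 - γ)) * (1 / warmupFactor γ ^ j) := by
        refine Finset.sum_le_sum fun j _ => ?_
        -- `2562` is `2560`, plus one for the ceiling, plus one for the single update sample.
        have c := Nat.ceil_lt_add_one (a := 2560 * L / ((1 - γ) * warmupFactor γ ^ j))
          (by positivity)
        have e : 2560 * L / ((1 - γ) * warmupFactor γ ^ j)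
            = 2560 * (L / (1 - γ)) * (1 / warmupFactor γ ^ j) := by field_simp
        have o : 1 ≤ 1 / warmupFactor γ ^ j := by
          rw [le_div_iff₀ (pow_pos hρ j), one_mul]
          exact pow_le_one₀ hρ.le (warmupFactor_lt_one h1).le
        have o2 := one_le_mul_of_one_le_of_one_le hh o
        rw [e] at c ⊢
        linarith
    _ = 2562 * (L / (1 - γ)) * ∑ j ∈ Finset.range (warmupLength γ), 1 / warmupFactor γ ^ j := by
        rw [Finset.mul_sum]
    _ ≤ 2562 * (L / (1 - γ)) * (8 / (1 - γ) ^ 2) := by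
        gcongr
        exact sum_inv_warmupFactor_pow_le h0 h1
    _ = _ := by field_simp; norm_num

/-- The case `k = 0` is kept apart because `4^(M-1) ≤ (B/ε)^2` can fail when `M = 1`; an empty
refinement must cost nothing. -/
theorem sum_four_pow_succ_le (k : ℕ) :
    3 * ∑ m ∈ Finset.range k, (4 : ℝ) ^ (m + 1) ≤ if k = 0 then 0 else 4 * 4 ^ k := by
  have : ∀ k : ℕ, 3 * ∑ m ∈ Finset.range k, (4 : ℝ) ^ (m + 1) = 4 * 4 ^ k - 4 := fun k => by
    induction k with
    | zero => simp
    | succ k ih => rw [Finset.sum_range_succ, mul_add, ih]; ring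
  split_ifs with h
  · simp [h]
  · rw [this]; linarith

theorem totalSamples_refinementPlan_le (h0 : 0 < γ) (h1 : γ < 1) {L L' : ℝ} (hL : 1 ≤ L)
    (hL' : 1 ≤ L') (k : ℕ) : (totalSamples (refinementPlan γ L L' k) : ℝ)
      ≤ 11521 * k * (L / (1 - γ) ^ 3)
        + 1400 * (if k = 0 then 0 else (4 : ℝ) ^ k) * (L' / (1 - γ) ^ 2) := by
  have hg : 0 < 1 - γ := by linarith
  have hh : 1 ≤ L / (1 - γ) ^ 3 := by
    rw [le_div_iff₀ (by positivity), one_mul]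
    exact (pow_le_one₀ hg.le (by linarith)).trans hL
  have hh' : 1 ≤ L' / (1 - γ) ^ 2 := by
    rw [le_div_iff₀ (by positivity), one_mul]
    exact (pow_le_one₀ hg.le (by linarith)).trans hL'
  rw [refinementPlan, totalSamples_map_range]
  push_cast
  calc _ ≤ ∑ m ∈ Finset.range k, (11521 * (L / (1 - γ) ^ 3)
        + 1025 * (L' / (1 - γ) ^ 2) * 4 ^ (m + 1)) := by
        refine Finset.sum_le_sum fun m _ => ?_
        have c := Nat.ceil_lt_add_one (a := 11520 * L / (1 - γ) ^ 3) (by positivity)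
        have c' := Nat.ceil_lt_add_one (a := 1024 * 4 ^ (m + 1) * L' / (1 - γ) ^ 2)
          (by positivity)
        have o : (1 : ℝ) ≤ 4 ^ (m + 1) := one_le_pow₀ (by norm_num)
        have o2 := one_le_mul_of_one_le_of_one_le o hh'
        rw [mul_div_assoc] at c c'
        rw [mul_div_assoc 11520, mul_div_assoc (1024 * 4 ^ (m + 1))]
        linarith
    _ = 11521 * k * (L / (1 - γ) ^ 3)
        + 1025 * (L' / (1 - γ) ^ 2) * ∑ m ∈ Finset.range k, (4 : ℝ) ^ (m + 1) := by
        rw [Finset.sum_add_distrib, Finset.sum_const, Finset.card_range, nsmul_eq_mul,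
          Finset.mul_sum]
        ring
    _ ≤ _ := by
        refine add_le_add le_rfl ?_
        have s := sum_four_pow_succ_le k
        have : ∑ m ∈ Finset.range k, (4 : ℝ) ^ (m + 1)
            ≤ 4 / 3 * (if k = 0 then 0 else (4 : ℝ) ^ k) := by
          split_ifs at s ⊢ <;> linarith
        have p : (0 : ℝ) ≤ if k = 0 then 0 else (4 : ℝ) ^ k := by split_ifs <;> positivity
        calc _ ≤ 1025 * (L' / (1 - γ) ^ 2) * (4 / 3 * (if k = 0 then 0 else (4 : ℝ) ^ k)) := by
              gcongr
          _ = 1025 * (4 / 3) * ((if k = 0 then 0 else (4 : ℝ) ^ k) * (L' / (1 - γ) ^ 2)) := by ring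
          _ ≤ 1400 * ((if k = 0 then 0 else (4 : ℝ) ^ k) * (L' / (1 - γ) ^ 2)) := by
              gcongr; norm_num
          _ = _ := by ring

variable {S A Ω : Type*} [Fintype S] [MeasurableSpace S]
  [MeasurableSingletonClass S] [Fintype A] [Nonempty A] [MeasurableSpace Ω]
  {μ : Measure Ω} [IsProbabilityMeasure μ] {r : S × A → ℝ} {P : S × A → PMF S}
  {θstar : S × A → ℝ}

omit [MeasurableSingletonClass S] [Nonempty A] in
theorem Reaches.mono {p : List (ℕ × ℕ)} {b b₁ b₂ q : ℝ}
    (h : Reaches μ γ r P θstar p b b₁ q) (hb : b₁ ≤ b₂) : Reaches μ γ r P θstar p b b₂ q :=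
  fun θ hθ X hX => (measureReal_mono (fun _ hω => lt_of_le_of_lt hb hω)
    (measure_ne_top _ _)).trans (h θ hθ X hX)

/-- Minimality of `warmupLength` keeps the error before each step above `B/2`, as the step requires.
The constant `2560 = 256 * 10` buys the exponent `10 * L`, which later absorbs powers of the
horizon. -/
theorem reaches_warmupPlan (h0 : 0 < γ) (h1 : γ < 1) (hopt : IsOptimalQ γ r P θstar)
    {B L : ℝ} (hB : 0 < B) (hσ : ‖sigma γ r P θstar‖ ≤ B) (hθ : ‖θstar‖ ≤ B / (1 - γ))
    (hL : 0 < L) :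
    Reaches μ γ r P θstar (warmupPlan γ L) (B / (1 - γ)) (B / 2)
      (warmupLength γ * (Fintype.card S * Fintype.card A * (2 * Real.exp (-(10 * L))))) := by
  have hg : 0 < 1 - γ := by linarith
  have hρ := warmupFactor_pos h0
  have key := Reaches.map_range (μ := μ) (γ := γ) (r := r) (P := P) (θstar := θstar)
    (n := warmupLength γ)
    (e := fun j => (1, ⌈2560 * L / ((1 - γ) * warmupFactor γ ^ j)⌉₊))
    (β := fun j => warmupFactor γ ^ j * (B / (1 - γ)))
    (q := Fintype.card S * Fintype.card A * (2 * Real.exp (-(10 * L)))) (by positivity)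
    fun j hj => by
      have hj' := lt_warmupFactor_pow hj
      have e : warmupFactor γ ^ (j + 1) * (B / (1 - γ))
          = (1 - (1 - γ) / 4) * (warmupFactor γ ^ j * (B / (1 - γ))) := by
        rw [pow_succ, warmupFactor]; ring
      change Reaches μ γ r P θstar _ _ (warmupFactor γ ^ (j + 1) * (B / (1 - γ))) _
      rw [e]
      refine reaches_valueIteration_step h0 h1 hopt hB hσ hθ ?_ ?_ (by positivity) ?_
      · rw [mul_div_assoc', le_div_iff₀ hg]
        nlinarith
      · exact mul_le_of_le_one_left (by positivity)
          (pow_le_one₀ hρ.le (warmupFactor_lt_one h1).le)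
      · refine le_of_eq_of_le ?_ (Nat.le_ceil _)
        field_simp
        norm_num
  simp only [pow_zero, one_mul] at key
  refine key.mono ?_
  calc warmupFactor γ ^ warmupLength γ * (B / (1 - γ)) ≤ (1 - γ) / 2 * (B / (1 - γ)) := by
        gcongr
        exact warmupFactor_pow_warmupLength_le h1
    _ = B / 2 := by field_simp

/-- Epoch `m` starts at error `b = B/2^(m+1)`, so `(B/b)^2 = 4^(m+1)`; again `11520 = 1152 * 10`. -/
theorem reaches_refinementPlan (h0 : 0 < γ) (h1 : γ < 1) (hopt : IsOptimalQ γ r P θstar)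
    {B L L' : ℝ} (hB : 0 < B) (hσ : ‖sigma γ r P θstar‖ ≤ B) (hθ : ‖θstar‖ ≤ B / (1 - γ))
    (hL : 1 ≤ L) (hL' : 0 < L') (k : ℕ) :
    Reaches μ γ r P θstar (refinementPlan γ L L' k) (B / 2) (B / 2 ^ (k + 1))
      (k * (Fintype.card S * Fintype.card A * (2 * Real.exp (-L'))
        + (⌈11520 * L / (1 - γ) ^ 3⌉₊ + 1)
          * (Fintype.card S * Fintype.card A * (2 * Real.exp (-(10 * L)))))) := by
  have hg : 0 < 1 - γ := by linarith
  have key := Reaches.map_range (μ := μ) (γ := γ) (r := r) (P := P) (θstar := θstar) (n := k)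
    (e := fun m => (⌈11520 * L / (1 - γ) ^ 3⌉₊, ⌈1024 * 4 ^ (m + 1) * L' / (1 - γ) ^ 2⌉₊))
    (β := fun m => B / 2 ^ (m + 1))
    (q := Fintype.card S * Fintype.card A * (2 * Real.exp (-L'))
        + (⌈11520 * L / (1 - γ) ^ 3⌉₊ + 1)
          * (Fintype.card S * Fintype.card A * (2 * Real.exp (-(10 * L))))) (by positivity)
    fun m _ => by
      have e : B / 2 ^ (m + 1 + 1) = B / 2 ^ (m + 1) / 2 := by rw [pow_succ 2 (m + 1)]; field_simp
      change Reaches μ γ r P θstar _ _ (B / 2 ^ (m + 1 + 1)) _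
      rw [e]
      refine reaches_varianceReduced_epoch h0 h1 hopt hσ hθ (by positivity) ?_ hL' (by linarith)
        ?_ ?_
      · exact div_le_self hB.le (one_le_pow₀ (by norm_num))
      · refine le_of_eq_of_le ?_ (Nat.le_ceil _)
        ring
      · refine le_of_eq_of_le ?_ (Nat.le_ceil _)
        rw [div_pow, ← pow_mul, mul_comm (m + 1) 2, pow_mul]
        norm_num
        field_simp
  simp only [zero_add, pow_one] at key
  exact key

/-- Here `y = exp (-L)`. The tenth power beats the polynomial number of events, with `L ≤ 1/y` for
the epoch length. Warm-up, recentering and inner noise take `δ/4`, `δ/4` and `δ/2`. -/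
theorem failure_le {h y d M δ L n K : ℝ} (hh : 1 ≤ h) (hy : 0 < y) (hd : 1 ≤ d) (hM : 1 ≤ M)
    (hδ : 0 < δ) (hδ1 : δ < 1) (he : 8 * M * d * h * y = δ) (hL : L ≤ 1 / y)
    (hn : n ≤ 8 * h ^ 2) (hK : K ≤ 11520 * L * h ^ 3 + 1) :
    n * (d * (2 * y ^ 10)) + (M - 1) * (d * (2 * (δ / (8 * M * d))) + (K + 1) * (d * (2 * y ^ 10)))
      ≤ δ := by
  have hMd : 1 ≤ M * d := one_le_mul_of_one_le_of_one_le hM hd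
  have hhy : h * y ≤ 1 / 8 := by
    have : 1 * (8 * (h * y)) ≤ M * d * (8 * (h * y)) := by gcongr
    linarith
  have hy1 : y ≤ 1 / 8 := by nlinarith
  have hdhy : d * (h * y) ≤ δ / 8 := by
    have : 1 * (d * (h * y)) ≤ M * (d * (h * y)) := by gcongr
    linarith
  have t1 : n * (d * (2 * y ^ 10)) ≤ δ / 4 := by
    calc n * (d * (2 * y ^ 10)) ≤ 8 * h ^ 2 * (d * (2 * y ^ 10)) := by gcongr
      _ = 16 * (d * (h * y)) * (h * y) * y ^ 8 := by ring
      _ ≤ 16 * (δ / 8) * (1 / 8) * 1 := by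
        gcongr
        exact pow_le_one₀ hy.le (by linarith)
      _ = δ / 4 := by ring
  have t2 : (M - 1) * (d * (2 * (δ / (8 * M * d)))) ≤ δ / 4 := by
    have : (M - 1) * (d * (2 * (δ / (8 * M * d)))) = δ / 4 * ((M - 1) / M) := by
      field_simp
      ring
    rw [this]
    refine mul_le_of_le_one_right (by positivity) ?_
    rw [div_le_one (by linarith)]
    linarith
  have hK2 : K + 1 ≤ 11522 * h ^ 3 / y := by
    have a : 11520 * L * h ^ 3 ≤ 11520 * (1 / y) * h ^ 3 := by gcongr
    have b : 1 ≤ h ^ 3 / y := by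
      rw [le_div_iff₀ hy]
      have : 1 ≤ h ^ 3 := one_le_pow₀ hh
      linarith
    have e : 11520 * (1 / y) * h ^ 3 = 11520 * (h ^ 3 / y) := by ring
    rw [mul_div_assoc]
    linarith
  have t3 : (M - 1) * ((K + 1) * (d * (2 * y ^ 10))) ≤ δ / 2 := by
    calc (M - 1) * ((K + 1) * (d * (2 * y ^ 10)))
        ≤ M * (11522 * h ^ 3 / y * (d * (2 * y ^ 10))) := by
          have : 0 ≤ 11522 * h ^ 3 / y * (d * (2 * y ^ 10)) := by positivity
          refine (mul_le_mul_of_nonneg_left (mul_le_mul_of_nonneg_right hK2 (by positivity))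
            (by linarith)).trans (mul_le_mul_of_nonneg_right (by linarith) this)
      _ = 23044 / 8 * (8 * M * d * h * y) * (h * y) ^ 2 * y ^ 6 := by field_simp; norm_num
      _ ≤ 23044 / 8 * δ * (1 / 8) ^ 2 * (1 / 8) ^ 6 := by
        rw [he]
        gcongr
      _ ≤ δ / 2 := by linarith
  linarith [t1, t2, t3]

end Plan

/-! ### Comparing the plan's cost with the two sample sizes. -/

section SampleSize

theorem one_le_numEpochs (B ε : ℝ) : 1 ≤ numEpochs B ε := le_max_left _ _

theorem le_two_pow_numEpochs {B ε : ℝ} (hB : 0 ≤ B) (hε : 0 < ε) :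
    B ≤ 2 ^ numEpochs B ε * ε := by
  rcases hB.eq_or_lt with rfl | hB
  · positivity
  · rw [← div_le_iff₀ hε]
    have h : Real.logb 2 (B / ε) ≤ (numEpochs B ε : ℝ) :=
      (Nat.le_ceil _).trans (by exact_mod_cast le_max_right _ _)
    rwa [Real.logb_le_iff_le_rpow one_lt_two (by positivity), Real.rpow_natCast] at h

theorem two_pow_lt_of_numEpochs {B ε : ℝ} (hB : 0 ≤ B) (hε : 0 < ε)
    (hM : numEpochs B ε - 1 ≠ 0) : 2 ^ (numEpochs B ε - 1) < B / ε := by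
  have hc : numEpochs B ε = ⌈Real.logb 2 (B / ε)⌉₊ := by
    unfold numEpochs at *
    omega
  have hlt : ((numEpochs B ε - 1 : ℕ) : ℝ) < Real.logb 2 (B / ε) := by
    rw [← Nat.lt_ceil]
    omega
  have hpos : 0 < B / ε := by
    -- For `B = 0` the convention `Real.logb 2 0 = 0` gives `M = 1`, contrary to `hM`.
    rcases hB.eq_or_lt with rfl | hB
    · simp only [zero_div, Real.logb_zero] at hlt
      exact absurd hlt (not_lt.2 (Nat.cast_nonneg _))
    · positivity
  rwa [Real.lt_logb_iff_rpow_lt one_lt_two hpos, Real.rpow_natCast] at hlt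

theorem numEpochs_sub_one_le {B ε : ℝ} (hB : 0 ≤ B) (hε : 0 < ε) :
    ((numEpochs B ε - 1 : ℕ) : ℝ) ≤ 3 / 2 * max 1 (Real.log (B / ε)) := by
  by_cases hM : numEpochs B ε - 1 = 0
  · rw [hM]
    have := le_max_left 1 (Real.log (B / ε))
    push_cast
    linarith
  · have h := Real.log_le_log (by positivity) (two_pow_lt_of_numEpochs hB hε hM).le
    rw [Real.log_pow] at h
    -- The factor `3/2` bounds `1 / log 2`.
    have h2 := Real.log_two_gt_d9
    have := le_max_right 1 (Real.log (B / ε))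
    have : (0 : ℝ) ≤ (numEpochs B ε - 1 : ℕ) := Nat.cast_nonneg _
    nlinarith

theorem one_le_log_of_eight_le {x : ℝ} (hx : 8 ≤ x) : 1 ≤ Real.log x := by
  rw [Real.le_log_iff_exp_le (by linarith)]
  have := Real.exp_one_lt_d9
  linarith

theorem eight_le_div {M D δ : ℝ} (hM : 1 ≤ M) (hD : 1 ≤ D) (hδ : 0 < δ) (hδ1 : δ ≤ 1) :
    8 ≤ 8 * M * D / δ := by
  rw [le_div_iff₀ hδ]
  have : 1 ≤ M * D := one_le_mul_of_one_le_of_one_le hM hD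
  linarith

theorem totalSamples_vrPlan_le {γ δ ε B : ℝ} (h0 : 0 < γ) (h1 : γ < 1) (hδ : 0 < δ)
    (hδ1 : δ < 1) (hε : 0 < ε) (hB : 0 ≤ B) {D : ℕ} (hD : 1 ≤ D) :
    (totalSamples (vrPlan γ δ D (numEpochs B ε)) : ℝ)
      ≤ sampleSize 40000 1400 γ D δ ε B := by
  have hg : 0 < 1 - γ := by linarith
  have hM := one_le_numEpochs B ε
  have hM1 : (1 : ℝ) ≤ numEpochs B ε := by exact_mod_cast hM
  have hD1 : (1 : ℝ) ≤ D := by exact_mod_cast hD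
  have hL := one_le_log_of_eight_le (eight_le_div hM1 hD1 (mul_pos hg hδ) (by nlinarith))
  have hL' := one_le_log_of_eight_le (eight_le_div hM1 hD1 hδ hδ1.le)
  rw [vrPlan, totalSamples_append]
  push_cast
  have w := totalSamples_warmupPlan_le h0 h1 hL
  have f := totalSamples_refinementPlan_le h0 h1 hL hL' (numEpochs B ε - 1)
  set L := Real.log (8 * (numEpochs B ε) * D / ((1 - γ) * δ))
  set L' := Real.log (8 * (numEpochs B ε) * D / δ)
  have hx : 0 ≤ L / (1 - γ) ^ 3 := by positivity
  have hx' : 0 ≤ L' / (1 - γ) ^ 2 := by positivity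
  have k1 := numEpochs_sub_one_le hB hε
  have k2 : (if numEpochs B ε - 1 = 0 then 0 else (4 : ℝ) ^ (numEpochs B ε - 1))
      ≤ (B / ε) ^ 2 := by
    split_ifs with h
    · positivity
    · calc (4 : ℝ) ^ (numEpochs B ε - 1) = (2 ^ (numEpochs B ε - 1)) ^ 2 := by
            rw [← pow_mul, mul_comm, pow_mul]; norm_num
        _ ≤ _ := pow_le_pow_left₀ (by positivity) (two_pow_lt_of_numEpochs hB hε h).le 2
  have k3 := le_max_left 1 (Real.log (B / ε))
  have m1 := mul_le_mul_of_nonneg_right k1 hx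
  have m2 := mul_le_mul_of_nonneg_right k2 hx'
  have m3 := mul_le_mul_of_nonneg_right k3 hx
  unfold sampleSize
  calc _ ≤ 20496 * (L / (1 - γ) ^ 3) + (11521 * (numEpochs B ε - 1 : ℕ) * (L / (1 - γ) ^ 3)
        + 1400 * (if numEpochs B ε - 1 = 0 then 0 else (4 : ℝ) ^ (numEpochs B ε - 1))
          * (L' / (1 - γ) ^ 2)) := add_le_add w f
    -- `20496 + 11521 * 3/2 ≤ 40000`.
    _ ≤ _ := by linarith

theorem one_le_of_mem_vrPlan {γ δ : ℝ} (h0 : 0 < γ) (h1 : γ < 1) (hδ : 0 < δ)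
    (hδ1 : δ < 1) {D M : ℕ} (hD : 1 ≤ D) (hM : 1 ≤ M) :
    ∀ e ∈ vrPlan γ δ D M, 1 ≤ e.1 ∧ 1 ≤ e.2 := by
  have hg : 0 < 1 - γ := by linarith
  have hM1 : (1 : ℝ) ≤ M := by exact_mod_cast hM
  have hD1 : (1 : ℝ) ≤ D := by exact_mod_cast hD
  have hL := one_le_log_of_eight_le (eight_le_div hM1 hD1 (mul_pos hg hδ) (by nlinarith))
  have hL' := one_le_log_of_eight_le (eight_le_div hM1 hD1 hδ hδ1.le)
  have hρ := warmupFactor_pos h0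
  intro e he
  simp only [vrPlan, warmupPlan, refinementPlan, List.mem_append, List.mem_map] at he
  rcases he with ⟨j, _, rfl⟩ | ⟨m, _, rfl⟩
  · exact ⟨le_rfl, Nat.one_le_ceil_iff.2 (by positivity)⟩
  · exact ⟨Nat.one_le_ceil_iff.2 (by positivity), Nat.one_le_ceil_iff.2 (by positivity)⟩

/-- The scalar comparison behind the worst-case bound: `h` is the effective horizon,
`u = (rmax / ε) ^ 2 * h`, and `R = 4 * rmax * h / ε`. -/
theorem worst_case_arith {h u R ℓ ℓM b m : ℝ} (hh : 1 ≤ h) (hu : 1 ≤ u) (hR : 1 ≤ Real.log R)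
    (hR2 : R ^ 2 = 16 * h * u) (hℓ : 1 ≤ ℓ) (hℓh : Real.log (8 * h) ≤ ℓ)
    (hb0 : 0 ≤ b) (hbR : b ≤ R) (hm1 : 1 ≤ m) (hm : m ≤ Real.log R)
    (hM : ℓM ≤ ℓ + 3 * Real.log R) :
    40000 * (ℓM * h ^ 3) * m + 1400 * b ^ 2 * (ℓM * h ^ 2)
      ≤ 400000 * (u * h ^ 3) * (ℓ * Real.log R) := by
  have hlogR : Real.log R ≤ ℓ + u / 2 := by
    have e : 2 * Real.log R = Real.log (16 * h) + Real.log u := by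
      rw [← Real.log_mul (by positivity) (by positivity), ← hR2, Real.log_pow]
      norm_num
    have a : Real.log u ≤ u := (Real.log_le_sub_one_of_pos (by linarith)).trans (by linarith)
    have c : Real.log (16 * h) ≤ Real.log (8 * h) + Real.log (8 * h) := by
      rw [← Real.log_mul (by positivity) (by positivity)]
      exact Real.log_le_log (by positivity) (by nlinarith)
    linarith
  set y := Real.log R
  have huℓ : u ≤ u * ℓ := le_mul_of_one_le_right (by linarith) hℓ
  have hℓu : ℓ ≤ u * ℓ := le_mul_of_one_le_left (by linarith) hu
  -- Two bounds on `ℓM`: the first term already carries `m ≤ log R`, so there the excess is paid for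
  -- by `u`; in the second, `b^2 ≤ R^2 = 16 * h * u` leaves room for `log R`.
  have e1 : ℓM ≤ 11 / 2 * (u * ℓ) := by linarith
  have e2 : ℓM ≤ 4 * (ℓ * y) := by
    have : ℓ ≤ ℓ * y := le_mul_of_one_le_right (by linarith) hR
    have : y ≤ ℓ * y := le_mul_of_one_le_left (by linarith) hℓ
    linarith
  have t1 : ℓM * h ^ 3 * m ≤ 11 / 2 * (u * ℓ) * h ^ 3 * y := by gcongr
  have t2 : b ^ 2 * (ℓM * h ^ 2) ≤ R ^ 2 * (4 * (ℓ * y) * h ^ 2) :=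
    calc b ^ 2 * (ℓM * h ^ 2) ≤ b ^ 2 * (4 * (ℓ * y) * h ^ 2) := by gcongr
      _ ≤ _ := by gcongr
  rw [hR2] at t2
  have p : 0 ≤ u * ℓ * h ^ 3 * y := by positivity
  nlinarith

variable {S A : Type*} [Fintype S] [Nonempty S] [MeasurableSpace S]
  [MeasurableSingletonClass S] [Fintype A] [Nonempty A] {γ : ℝ} {r : S × A → ℝ}
  {P : S × A → PMF S} {θstar : S × A → ℝ}

omit [MeasurableSingletonClass S] in
theorem norm_optimalQ_le (h0 : 0 < γ) (h1 : γ < 1) (hopt : IsOptimalQ γ r P θstar) {rmax : ℝ}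
    (hr : ∀ sa, |r sa| ≤ rmax) : ‖θstar‖ ≤ rmax / (1 - γ) := by
  have hrm : 0 ≤ rmax := (abs_nonneg _).trans (hr (Classical.arbitrary _))
  have : ‖θstar‖ ≤ rmax + γ * ‖θstar‖ := by
    rw [pi_norm_le_iff_of_nonneg (by positivity)]
    intro sa
    have e : θstar sa = r sa + γ * ∫ s, vmax θstar s ∂(P sa).toMeasure := by
      conv_lhs => rw [← hopt]
      rfl
    rw [e, Real.norm_eq_abs]
    refine (abs_add_le _ _).trans (add_le_add (hr sa) ?_)
    rw [abs_mul, abs_of_pos h0]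
    exact mul_le_mul_of_nonneg_left (abs_integral_le_of_abs_le (abs_vmax_le θstar)) h0.le
  rw [le_div_iff₀ (by linarith)]
  linarith

omit [Nonempty S] in
theorem norm_sigma_le (h0 : 0 < γ) (h1 : γ < 1) (r : S × A → ℝ) (P : S × A → PMF S)
    (θ : S × A → ℝ) : ‖sigma γ r P θ‖ ≤ ‖θ‖ := by
  rw [pi_norm_le_iff_of_nonneg (norm_nonneg _)]
  intro sa
  rw [Real.norm_eq_abs]
  refine abs_le_of_sq_le_sq ?_ (norm_nonneg _)
  rw [sigma_sq, variance_const_mul]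
  have := variance_le_sq_of_bounded (μ := (P sa).toMeasure) (X := vmax θ) (a := -‖θ‖) (b := ‖θ‖)
    (Filter.Eventually.of_forall fun s => abs_le.1 (abs_vmax_le θ s))
    Measurable.of_discrete.aemeasurable
  rw [show (‖θ‖ - -‖θ‖) / 2 = ‖θ‖ by ring] at this
  exact (mul_le_of_le_one_left (variance_nonneg _ _) (pow_le_one₀ h0.le h1.le)).trans this

omit [Nonempty S] [MeasurableSingletonClass S] [Nonempty A] in
theorem B0_nonneg (h1 : γ < 1) : 0 ≤ B0 γ r P θstar :=
  add_nonneg (norm_nonneg _) (mul_nonneg (norm_nonneg _) (by linarith))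

theorem B0_le (h0 : 0 < γ) (h1 : γ < 1) (hopt : IsOptimalQ γ r P θstar) {rmax : ℝ}
    (hr : ∀ sa, |r sa| ≤ rmax) : B0 γ r P θstar ≤ rmax * (2 / (1 - γ) + 1) := by
  have hg : 0 < 1 - γ := by linarith
  have hrm : 0 ≤ rmax := (abs_nonneg _).trans (hr (Classical.arbitrary _))
  have hθ := norm_optimalQ_le h0 h1 hopt hr
  have hσ := (norm_sigma_le h0 h1 r P θstar).trans hθ
  have : ‖θstar‖ * (1 - γ) ≤ rmax := (le_div_iff₀ hg).1 hθ
  have : 0 ≤ rmax / (1 - γ) := by positivity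
  have e : rmax * (2 / (1 - γ) + 1) = 2 * (rmax / (1 - γ)) + rmax := by ring
  rw [B0, e]
  linarith

theorem sampleSize_le_worstSampleSize {γ δ ε B rmax : ℝ} (h0 : 0 < γ) (h1 : γ < 1) (hδ : 0 < δ)
    (hδ1 : δ < 1) (hε : 0 < ε) (hB : 0 ≤ B) (hBr : B ≤ 4 * rmax / (1 - γ)) {D : ℕ} (hD : 1 ≤ D)
    (hεr : ε ≤ rmax / √(1 - γ)) :
    sampleSize 40000 1400 γ D δ ε B ≤ worstSampleSize 400000 γ D δ ε rmax := by
  have hg : 0 < 1 - γ := by linarith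
  have hD1 : (1 : ℝ) ≤ D := by exact_mod_cast hD
  have hs : 0 < √(1 - γ) := Real.sqrt_pos.2 hg
  rw [le_div_iff₀ hs] at hεr
  have hrm : 0 < rmax := lt_of_lt_of_le (by positivity) hεr
  have hM1 : (1 : ℝ) ≤ numEpochs B ε := by exact_mod_cast one_le_numEpochs B ε
  obtain ⟨h, hh⟩ : ∃ h, h = 1 / (1 - γ) := ⟨_, rfl⟩
  have hhg : h * (1 - γ) = 1 := by rw [hh]; field_simp
  have hh1 : 1 ≤ h := by nlinarith
  have hg' : 1 - γ = 1 / h := by rw [hh]; field_simp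
  -- The accuracy condition on `ε` is used in this form, which says `u ≥ 1`.
  have hε2 : ε ^ 2 ≤ rmax ^ 2 * h := by
    have := pow_le_pow_left₀ (by positivity) hεr 2
    rw [mul_pow, Real.sq_sqrt hg.le, hg', mul_one_div, div_le_iff₀ (by linarith)] at this
    exact this
  set u := rmax ^ 2 * h / ε ^ 2 with hu
  have hu1 : 1 ≤ u := by rw [hu, le_div_iff₀ (by positivity), one_mul]; exact hε2
  set R := 4 * rmax / ((1 - γ) * ε) with hR
  have hRh : R = 4 * rmax * h / ε := by rw [hR, hh]; field_simp
  have hR0 : 0 < R := by rw [hRh]; positivity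
  have hR2 : R ^ 2 = 16 * h * u := by rw [hRh, hu]; field_simp; norm_num
  have hR4 : 4 ≤ R := by
    refine (abs_le_of_sq_le_sq' ?_ hR0.le).2
    rw [hR2]
    nlinarith
  have hlogR : 1 ≤ Real.log R := by
    rw [Real.le_log_iff_exp_le hR0]
    have := Real.exp_one_lt_d9
    linarith
  have hBR : B / ε ≤ R := by
    rw [hRh, div_le_div_iff_of_pos_right hε]
    refine hBr.trans_eq ?_
    rw [hh]; ring
  have hb0 : 0 ≤ B / ε := by positivity
  have hlogB : Real.log (B / ε) ≤ Real.log R := by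
    rcases hb0.eq_or_lt with h | h
    · rw [← h, Real.log_zero]; linarith
    · exact Real.log_le_log h hBR
  have hm := max_le hlogR hlogB
  set ℓ := Real.log (8 * D / ((1 - γ) * δ)) with hℓ
  have hδh : 8 * h ≤ 8 * D / ((1 - γ) * δ) := by
    rw [le_div_iff₀ (by positivity), hg']
    field_simp
    linarith
  have hℓh : Real.log (8 * h) ≤ ℓ := Real.log_le_log (by positivity) hδh
  have hℓ1 : 1 ≤ ℓ := one_le_log_of_eight_le (by linarith)
  have hLM : Real.log (8 * numEpochs B ε * D / ((1 - γ) * δ)) ≤ ℓ + 3 * Real.log R := by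
    have e : (8 * numEpochs B ε * D / ((1 - γ) * δ) : ℝ)
        = 8 * D / ((1 - γ) * δ) * numEpochs B ε := by ring
    rw [e, Real.log_mul (by positivity) (by positivity)]
    have a := Real.log_le_sub_one_of_pos (by linarith : (0 : ℝ) < numEpochs B ε)
    have c := numEpochs_sub_one_le hB hε
    rw [Nat.cast_sub (one_le_numEpochs B ε)] at c
    push_cast at c
    linarith
  have hLL : Real.log (8 * numEpochs B ε * D / δ)
      ≤ Real.log (8 * numEpochs B ε * D / ((1 - γ) * δ)) := by
    refine Real.log_le_log (by positivity) (div_le_div_of_nonneg_left (by positivity)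
      (by positivity) ?_)
    exact mul_le_of_le_one_left hδ.le (by linarith)
  have key := worst_case_arith hh1 hu1 hlogR hR2 hℓ1 hℓh hb0 hBR (le_max_left _ _) hm hLM
  unfold sampleSize worstSampleSize
  rw [← hR, ← hℓ]
  set LM := Real.log (8 * numEpochs B ε * D / ((1 - γ) * δ))
  set L' := Real.log (8 * numEpochs B ε * D / δ)
  have e1 : ∀ z : ℝ, ∀ n : ℕ, z / (1 - γ) ^ n = z * h ^ n := fun z n => by
    rw [hh, one_div, inv_pow, div_eq_mul_inv]
  rw [e1, e1, e1]
  have e2 : 400000 * (rmax ^ 2 / ε ^ 2) * (ℓ * Real.log R * h ^ 4)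
      = 400000 * (u * h ^ 3) * (ℓ * Real.log R) := by rw [hu]; ring
  rw [e2]
  refine le_trans (add_le_add le_rfl ?_) key
  gcongr

end SampleSize

/-! ### Accuracy of the output. -/

section Accuracy

variable {S A Ω : Type*} [Fintype S] [Nonempty S] [MeasurableSpace S]
  [MeasurableSingletonClass S] [Fintype A] [Nonempty A] [MeasurableSpace Ω]
  {μ : Measure Ω} [IsProbabilityMeasure μ] {γ : ℝ} {r : S × A → ℝ} {P : S × A → PMF S}
  {θstar : S × A → ℝ}

theorem vrQLearning_accuracy (h0 : 0 < γ) (h1 : γ < 1) (hopt : IsOptimalQ γ r P θstar)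
    {δ ε : ℝ} (hδ : 0 < δ) (hδ1 : δ < 1) (hε : 0 < ε) {X : ℕ → Ω → S × A → S}
    (hX : IsGenerativeSampling P μ X) :
    1 - δ ≤ μ.real {ω | ‖vrQLearning γ r (vrPlan γ δ (Fintype.card S * Fintype.card A)
      (numEpochs (B0 γ r P θstar) ε)) (fun i => X i ω) - θstar‖ ≤ ε} := by
  have hg : 0 < 1 - γ := by linarith
  set B := B0 γ r P θstar with hBdef
  set M := numEpochs B ε with hMdef
  set D := Fintype.card S * Fintype.card A with hDdef
  have hM : 1 ≤ M := one_le_numEpochs B ε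
  have hM1 : (1 : ℝ) ≤ M := by exact_mod_cast hM
  have hD1 : (1 : ℝ) ≤ D := by
    have : 1 ≤ D := Nat.mul_pos Fintype.card_pos Fintype.card_pos
    exact_mod_cast this
  have hDc : (Fintype.card S * Fintype.card A : ℝ) = D := by rw [hDdef]; push_cast; rfl
  have hBB : B ≤ 2 ^ M * ε := le_two_pow_numEpochs (B0_nonneg h1) hε
  -- The smallest scale known from `M` and `ε` to dominate `B₀`; after `M - 1` halvings of `B'/2` it
  -- ends exactly at `ε`.
  set B' := 2 ^ M * ε with hB'
  have hB'0 : 0 < B' := by positivity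
  have hθn : 0 ≤ ‖θstar‖ * (1 - γ) := by positivity
  have hσn : 0 ≤ ‖sigma γ r P θstar‖ := norm_nonneg _
  have hsum : ‖sigma γ r P θstar‖ + ‖θstar‖ * (1 - γ) ≤ B' := hBB
  have hσ : ‖sigma γ r P θstar‖ ≤ B' := by linarith
  have hθ : ‖θstar‖ ≤ B' / (1 - γ) := by rw [le_div_iff₀ hg]; linarith
  have hX8 := eight_le_div hM1 hD1 (mul_pos hg hδ) (by nlinarith)
  have hL := one_le_log_of_eight_le hX8
  have hX8' := eight_le_div hM1 hD1 hδ hδ1.le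
  have hL' := one_le_log_of_eight_le hX8'
  have reach := (reaches_warmupPlan (μ := μ) h0 h1 hopt hB'0 hσ hθ (zero_lt_one.trans_le hL)).append
    (reaches_refinementPlan h0 h1 hopt hB'0 hσ hθ hL (zero_lt_one.trans_le hL') (M - 1))
    (by positivity)
  rw [Nat.sub_add_cancel hM, hB', mul_div_cancel_left₀ ε (by positivity), hDc] at reach
  have hfail := reach 0 (by simpa using hθ) X hX
  have hlt : ((M - 1 : ℕ) : ℝ) = M - 1 := by rw [Nat.cast_sub hM]; simp
  have he1 : Real.exp (-Real.log (8 * M * D / δ)) = δ / (8 * M * D) := by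
    rw [Real.exp_neg, Real.exp_log (by linarith), inv_div]
  have he2 : Real.exp (-(10 * Real.log (8 * M * D / ((1 - γ) * δ))))
      = ((1 - γ) * δ / (8 * M * D)) ^ 10 := by
    rw [Real.exp_neg, ← Nat.cast_ofNat (R := ℝ), Real.exp_nat_mul, Real.exp_log (by linarith),
      ← inv_pow, inv_div]
  rw [he1, he2, hlt] at hfail
  have hy0 : 0 < (1 - γ) * δ / (8 * M * D) := by positivity
  have hfl := failure_le (h := 1 / (1 - γ)) (y := (1 - γ) * δ / (8 * M * D)) (d := D) (M := M)
    (δ := δ) (L := Real.log (8 * M * D / ((1 - γ) * δ))) (n := warmupLength γ)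
    (K := ⌈11520 * Real.log (8 * M * D / ((1 - γ) * δ)) / (1 - γ) ^ 3⌉₊)
    (by rw [le_div_iff₀ hg]; linarith) hy0 hD1 hM1 hδ hδ1 (by field_simp)
    (by
      rw [one_div_div]
      exact (Real.log_le_sub_one_of_pos (by linarith)).trans (by linarith))
    (by refine (warmupLength_le h0 h1).trans_eq ?_; field_simp)
    (by
      refine (Nat.ceil_lt_add_one (by positivity)).le.trans_eq ?_
      field_simp)
  have hbad := hfail.trans hfl
  have hcover : 1 ≤ μ.real {ω | ‖vrQLearning γ r (vrPlan γ δ D M) (fun i => X i ω) - θstar‖ ≤ ε}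
      + μ.real {ω | ε < ‖vrQLearning γ r (vrPlan γ δ D M) (fun i => X i ω) - θstar‖} := by
    rw [← probReal_univ (μ := μ)]
    refine (measureReal_mono ?_ (measure_ne_top _ _)).trans (measureReal_union_le _ _)
    intro ω _
    exact le_or_gt _ ε
  have hbad' : μ.real {ω | ε < ‖vrQLearning γ r (vrPlan γ δ D M) (fun i => X i ω) - θstar‖}
      ≤ δ := hbad
  linarith

end Accuracy

end VRQ

theorem corollary1 :
    ∃ (c c' C : ℝ) (plan : (γ δ : ℝ) → (D M : ℕ) → List (ℕ × ℕ)),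
      0 < c ∧ 0 < c' ∧ 0 < C ∧
      ∀ (S A : Type*) [Fintype S] [Nonempty S] [MeasurableSpace S] [MeasurableSingletonClass S]
        [Fintype A] [Nonempty A]
        (γ : ℝ) (r : S × A → ℝ) (P : S × A → PMF S) (θstar : S × A → ℝ) (δ ε : ℝ),
        0 < γ → γ < 1 → VRQ.IsOptimalQ γ r P θstar → 0 < δ → δ < 1 → 0 < ε →
        ∀ (D M : ℕ) (B T : ℝ) (p : List (ℕ × ℕ)),
          D = Fintype.card S * Fintype.card A →
          B = VRQ.B0 γ r P θstar →
          M = VRQ.numEpochs B ε →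
          T = VRQ.sampleSize c c' γ D δ ε B →
          p = plan γ δ D M →
          -- the run is a legitimate one and uses at most `T` matrix samples
          (∀ e ∈ p, 1 ≤ e.1 ∧ 1 ≤ e.2) ∧
          (VRQ.totalSamples p : ℝ) ≤ T ∧
          -- its output is `ε`-accurate with probability at least `1 - δ`
          (∀ (Ω : Type*) [MeasurableSpace Ω] (μ : MeasureTheory.Measure Ω)
            [MeasureTheory.IsProbabilityMeasure μ] (X : ℕ → Ω → S × A → S),
            VRQ.IsGenerativeSampling P μ X →
            1 - δ ≤ μ.real {ω | ‖VRQ.vrQLearning γ r p (fun i => X i ω) - θstar‖ ≤ ε}) ∧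
          -- worst case over bounded rewards
          (∀ rmax : ℝ, (∀ sa, |r sa| ≤ rmax) →
            B ≤ rmax * (2 / (1 - γ) + 1) ∧
            rmax * (2 / (1 - γ) + 1) ≤ 4 * rmax / (1 - γ) ∧
            (ε ≤ rmax / √(1 - γ) → T ≤ VRQ.worstSampleSize C γ D δ ε rmax)) := by
  refine ⟨40000, 1400, 400000, VRQ.vrPlan, by norm_num, by norm_num, by norm_num, ?_⟩
  intro S A _ _ _ _ _ _ γ r P θstar δ ε h0 h1 hopt hδ hδ1 hε D M B T p hD hB hM hT hp
  have hD1 : 1 ≤ D := hD ▸ Nat.mul_pos Fintype.card_pos Fintype.card_pos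
  have hB0 : 0 ≤ B := hB ▸ VRQ.B0_nonneg h1
  refine ⟨?_, ?_, ?_, ?_⟩
  · rw [hp]
    exact VRQ.one_le_of_mem_vrPlan h0 h1 hδ hδ1 hD1 (hM ▸ VRQ.one_le_numEpochs B ε)
  · rw [hp, hT, hM]
    exact VRQ.totalSamples_vrPlan_le h0 h1 hδ hδ1 hε hB0 hD1
  · intro Ω _ μ _ X hX
    subst hp hM hB hD
    exact VRQ.vrQLearning_accuracy h0 h1 hopt hδ hδ1 hε hX
  · intro rmax hr
    have hrm : 0 ≤ rmax := (abs_nonneg _).trans (hr (Classical.arbitrary _))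
    have hg : 0 < 1 - γ := by linarith
    have hBr : B ≤ rmax * (2 / (1 - γ) + 1) := hB ▸ VRQ.B0_le h0 h1 hopt hr
    have hr4 : rmax * (2 / (1 - γ) + 1) ≤ 4 * rmax / (1 - γ) := by
      rw [div_add_one hg.ne', mul_div_assoc', div_le_div_iff_of_pos_right hg]
      nlinarith
    refine ⟨hBr, hr4, fun hεr => ?_⟩
    rw [hT]
    exact VRQ.sampleSize_le_worstSampleSize h0 h1 hδ hδ1 hε hB0 (hBr.trans hr4) hD1 hεr
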